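/- Let $k$ be a field of characteristic $\neq 2$, let $A$ be a (commutative, unital) Poisson $k$-algebra, and let $n\ge 0$ be such that $A^{\otimes n}$ (tensor power over $k$) is an integral domain. Equip $A^{\otimes n}$ with its Poisson bracket $$\{a_1\otimes\cdots\otimes a_n,\,b_1\otimes\cdots\otimes b_n\}=\sum_{i=1}^n a_1b_1\otimes\cdots\otimes\{a_i,b_i\}\otimes\cdots\otimes a_nb_n ,$$ and its fraction field $K=\operatorname{Frac}(A^{\otimes n})$ with the unique Poisson structure extending it. Let $f_0,\dots,f_n\in A$ be linearly independent over $k$. For $g_1,\dots,g_n\in A$ put $[g_1,\dots,g_n]=\sum_{\sigma\in S_n}\varepsilon(\sigma)\,g_{\sigma(1)}\otimes\cdots\otimes g_{\sigma(n)}\in A^{\otimes n}$, and set $\Delta_i=[f_0,\dots,f_{i-1},f_{i+1},\dots,f_n]$ for $0\le i\le n$ and $h_i=\Delta_i/\Delta_0\in K$ for $1\le i\le n$. A quantization of a Poisson $k$-algebra $B$ is an associative unital $k[[\hbar]]$-algebra $B_\hbar$ which is topologically free as a $k[[\hbar]]$-module (i.e. isomorphic to $V[[\hbar]]$ for some $k$-vector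 space $V$), together with an isomorphism of $k$-algebras $B_\hbar/\hbar B_\hbar\simeq B$ under which $\{x \bmod \hbar,\,y\bmod\hbar\}=\hbar^{-1}(xy-yx)\bmod \hbar$ for all $x,y\in B_\hbar$. A quantization of the family $(h_i)_{1\le i\le n}$ is a quantization $K_\hbar$ of $K$ together with pairwise commuting elements $(h_1)_\hbar,\dots,(h_n)_\hbar\in K_\hbar$ such that $(h_i)_\hbar\bmod\hbar=h_i$ for all $i$. Proposition. If the Poisson algebra $A$ has a quantization $A_\hbar$, then $\Delta_0\neq 0$ (so that the $h_i$ are well defined) and the family $(h_i)_{1\le i\le n}$ has a quantization. -/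

import Mathlib

open scoped TensorProduct

universe u v w

/-! ### Poisson algebras -/

/-- A Poisson structure on a commutative `R`-algebra `B`: a Lie bracket which is a biderivation. -/
structure PoissonStructure (R B : Type*) [CommRing R] [CommRing B] [Algebra R B] where
  bracket : B →ₗ[R] B →ₗ[R] B
  bracket_self : ∀ a, bracket a a = 0
  jacobi : ∀ a b c,
    bracket a (bracket b c) + bracket b (bracket c a) + bracket c (bracket a b) = 0
  leibniz : ∀ a b c, bracket a (b * c) = bracket a b * c + b * bracket a c

namespace PoissonStructure

section Basic

variable {R B : Type*} [CommRing R] [CommRing B] [Algebra R B]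

theorem skew (P : PoissonStructure R B) (a b : B) : P.bracket a b = -P.bracket b a := by
  have h := P.bracket_self (a + b)
  simp only [map_add, LinearMap.add_apply, P.bracket_self, zero_add, add_zero] at h
  exact eq_neg_of_add_eq_zero_right h

/-- The Hamiltonian derivation `{a, ·}`. -/
def ham (P : PoissonStructure R B) (a : B) : Derivation R B B :=
  Derivation.mk' (P.bracket a) (by
    intro b c
    rw [P.leibniz, smul_eq_mul, smul_eq_mul, mul_comm (P.bracket a b) c, add_comm])

@[simp] theorem ham_apply (P : PoissonStructure R B) (a b : B) : P.ham a b = P.bracket a b := rfl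

/-- The Jacobi identity in the form `{{x, y}, z} = {x, {y, z}} - {y, {x, z}}`, packed as the
vanishing of a derivation. -/
theorem jacobi_of_derivation (β : B →ₗ[R] Derivation R B B) (hs : ∀ a, β a a = 0) (s : Set B)
    (hext : ∀ D : Derivation R B B, (∀ x ∈ s, D x = 0) → D = 0)
    (hj : ∀ a ∈ s, ∀ b ∈ s, ∀ c ∈ s, β a (β b c) + β b (β c a) + β c (β a b) = 0) (a b c : B) :
    β a (β b c) + β b (β c a) + β c (β a b) = 0 := by
  have sk : ∀ a b, β a b = -β b a := by
    intro a b
    have h := hs (a + b)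
    simp only [map_add, Derivation.add_apply, hs, zero_add, add_zero] at h
    exact eq_neg_of_add_eq_zero_right h
  have key : ∀ a b, (∀ c ∈ s, β a (β b c) + β b (β c a) + β c (β a b) = 0) →
      ∀ c, β a (β b c) + β b (β c a) + β c (β a b) = 0 := by
    intro a b h c
    have e : ∀ c, (⁅β a, β b⁆ - β (β a b)) c
        = β a (β b c) + β b (β c a) + β c (β a b) := by
      intro c
      rw [Derivation.sub_apply, Derivation.commutator_apply, sk c a, sk c (β a b), map_neg]
      ring
    rw [← e, hext (⁅β a, β b⁆ - β (β a b)) (fun x hx => by rw [e]; exact h x hx)]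
    rfl
  have rot : ∀ a b c, β a (β b c) + β b (β c a) + β c (β a b)
      = β b (β c a) + β c (β a b) + β a (β b c) := by intro a b c; ring
  have h1 : ∀ a ∈ s, ∀ b ∈ s, ∀ c, β a (β b c) + β b (β c a) + β c (β a b) = 0 :=
    fun a ha b hb => key a b (hj a ha b hb)
  have h2 : ∀ a ∈ s, ∀ b c, β a (β b c) + β b (β c a) + β c (β a b) = 0 := by
    intro a ha b c
    rw [rot, rot]
    refine key c a (fun b hb => ?_) b
    rw [rot]
    exact h1 a ha b hb c
  rw [rot]
  refine key b c (fun a ha => ?_) a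
  rw [← rot]
  exact h2 a ha b c

end Basic

/-! ### The Poisson structure on the fraction field -/

section Fraction

variable {R B : Type*} [CommRing R] [CommRing B] [IsDomain B] [Algebra R B]

theorem derivation_fraction_ext {D : Derivation R (FractionRing B) (FractionRing B)}
    (h : ∀ x ∈ Set.range (algebraMap B (FractionRing B)), D x = 0) : D = 0 := by
  ext x
  obtain ⟨⟨a, s⟩, hs⟩ := IsLocalization.surj (nonZeroDivisors B) x
  have h0 : algebraMap B (FractionRing B) s ≠ 0 :=
    IsFractionRing.to_map_ne_zero_of_mem_nonZeroDivisors s.2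
  have := congrArg D hs
  simp only [Derivation.leibniz] at this
  rw [h _ ⟨_, rfl⟩, h _ ⟨_, rfl⟩, smul_zero, zero_add, smul_eq_mul] at this
  simpa [h0] using this

/-- The extension to the fraction field of a derivation `B → Frac B`. -/
noncomputable def extendDerivation (D : Derivation R B (FractionRing B)) :
    Derivation R (FractionRing B) (FractionRing B) :=
  haveI : Algebra.FormallyEtale B (FractionRing B) :=
    Algebra.FormallyEtale.of_isLocalization (nonZeroDivisors B)
  ((KaehlerDifferential.isBaseChange_of_formallyEtale R B (FractionRing B)).lift
    D.liftKaehlerDifferential).compDer (KaehlerDifferential.D R (FractionRing B))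

@[simp] theorem extendDerivation_algebraMap (D : Derivation R B (FractionRing B)) (b : B) :
    extendDerivation D (algebraMap B (FractionRing B) b) = D b := by
  have : Algebra.FormallyEtale B (FractionRing B) :=
    Algebra.FormallyEtale.of_isLocalization (nonZeroDivisors B)
  have := (KaehlerDifferential.isBaseChange_of_formallyEtale R B (FractionRing B)).lift_eq
    D.liftKaehlerDifferential (KaehlerDifferential.D R B b)
  rw [KaehlerDifferential.map_D, Derivation.liftKaehlerDifferential_comp_D] at this
  exact this

theorem extendDerivation_unique {D : Derivation R B (FractionRing B)}
    {E : Derivation R (FractionRing B) (FractionRing B)}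
    (h : ∀ b, E (algebraMap B (FractionRing B) b) = D b) : E = extendDerivation D := by
  rw [← sub_eq_zero]
  apply derivation_fraction_ext
  rintro _ ⟨b, rfl⟩
  simp [h]

/-- Extension of derivations as a linear map. -/
noncomputable def extendDerivationLinear : Derivation R B (FractionRing B) →ₗ[R]
    Derivation R (FractionRing B) (FractionRing B) where
  toFun D := extendDerivation D
  map_add' D E := (extendDerivation_unique (by simp)).symm
  map_smul' r D := (extendDerivation_unique (by simp)).symm

/-- `{b, ·}` for `b : B`, extended to the fraction field. -/
noncomputable def hamExtend (P : PoissonStructure R B) :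
    B →ₗ[R] Derivation R (FractionRing B) (FractionRing B) where
  toFun b := extendDerivation ((Algebra.linearMap B (FractionRing B)).compDer (P.ham b))
  map_add' a b := (extendDerivation_unique (by intro c; simp)).symm
  map_smul' r b := (extendDerivation_unique (by
    intro c
    have : P.ham (r • b) = r • P.ham b := by ext; simp
    rw [this]
    simp)).symm

@[simp] theorem hamExtend_algebraMap (P : PoissonStructure R B) (a b : B) :
    P.hamExtend a (algebraMap B (FractionRing B) b)
      = algebraMap B (FractionRing B) (P.bracket a b) := by
  simp [hamExtend]

theorem hamExtend_mul (P : PoissonStructure R B) (a b : B) (y : FractionRing B) :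
    P.hamExtend (a * b) y = algebraMap B (FractionRing B) a * P.hamExtend b y
      + algebraMap B (FractionRing B) b * P.hamExtend a y := by
  have h : algebraMap B (FractionRing B) a • P.hamExtend b
      + algebraMap B (FractionRing B) b • P.hamExtend a = P.hamExtend (a * b) := by
    refine extendDerivation_unique ?_
    intro c
    have : P.bracket (a * b) c = a * P.bracket b c + b * P.bracket a c := by
      rw [P.skew, P.leibniz, P.skew c a, P.skew c b]; ring
    simp [this, Algebra.smul_def]
  rw [← h]
  simp [Algebra.smul_def]

/-- For `y` in the fraction field, the derivation `b ↦ {b, y}` from `B` to the fraction field. -/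
noncomputable def hamFlip (P : PoissonStructure R B) (y : FractionRing B) :
    Derivation R B (FractionRing B) :=
  Derivation.mk' { toFun := fun b => P.hamExtend b y
                   map_add' := fun a b => by simp
                   map_smul' := fun r b => by simp } (by
    intro a b
    simp [hamExtend_mul, Algebra.smul_def])

/-- The map `y ↦ {y, ·}` for the extended bracket on the fraction field. -/
noncomputable def hamFraction (P : PoissonStructure R B) :
    FractionRing B →ₗ[R] Derivation R (FractionRing B) (FractionRing B) where
  toFun y := -extendDerivation (P.hamFlip y)
  map_add' x y := by
    rw [← neg_add, neg_inj]
    exact (extendDerivation_unique (by intro b; simp [hamFlip])).symm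
  map_smul' r y := by
    rw [RingHom.id_apply, smul_neg, neg_inj]
    exact (extendDerivation_unique (by intro b; simp [hamFlip])).symm

theorem hamFraction_algebraMap_right (P : PoissonStructure R B) (y : FractionRing B) (b : B) :
    P.hamFraction y (algebraMap B (FractionRing B) b) = -P.hamExtend b y := by
  simp [hamFraction, hamFlip]

theorem hamFraction_algebraMap_left (P : PoissonStructure R B) (b : B) :
    P.hamFraction (algebraMap B (FractionRing B) b) = P.hamExtend b := by
  rw [← sub_eq_zero]
  apply derivation_fraction_ext
  rintro _ ⟨c, rfl⟩
  rw [Derivation.sub_apply, hamFraction_algebraMap_right, hamExtend_algebraMap,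
    hamExtend_algebraMap, P.skew b c]
  simp

theorem hamFraction_mul (P : PoissonStructure R B) (x y z : FractionRing B) :
    P.hamFraction (x * y) z = x * P.hamFraction y z + y * P.hamFraction x z := by
  have h : P.hamFraction (x * y) - (x • P.hamFraction y + y • P.hamFraction x) = 0 := by
    apply derivation_fraction_ext
    rintro _ ⟨b, rfl⟩
    simp only [Derivation.sub_apply, Derivation.add_apply, Derivation.smul_apply,
      hamFraction_algebraMap_right, Derivation.leibniz, smul_eq_mul]
    ring
  rw [sub_eq_zero] at h
  rw [h]
  simp

theorem hamFraction_skew (P : PoissonStructure R B) (x y : FractionRing B) :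
    P.hamFraction x y = -P.hamFraction y x := by
  let F : Derivation R (FractionRing B) (FractionRing B) :=
    Derivation.mk' { toFun := fun z => P.hamFraction z x
                     map_add' := fun a b => by simp
                     map_smul' := fun r b => by simp } (by
      intro a b
      simp [hamFraction_mul])
  have h : P.hamFraction x + F = 0 := by
    apply derivation_fraction_ext
    rintro _ ⟨b, rfl⟩
    simp [F, hamFraction_algebraMap_right, hamFraction_algebraMap_left]
  have := congrArg (fun D => D y) h
  exact eq_neg_of_add_eq_zero_left this

theorem hamFraction_self (P : PoissonStructure R B) (x : FractionRing B) :
    P.hamFraction x x = 0 := by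
  obtain ⟨⟨a, s⟩, hs⟩ := IsLocalization.surj (nonZeroDivisors B) x
  have h0 : algebraMap B (FractionRing B) s ≠ 0 :=
    IsFractionRing.to_map_ne_zero_of_mem_nonZeroDivisors s.2
  have hB : ∀ b : B, P.hamFraction (algebraMap B _ b) (algebraMap B _ b) = 0 := by
    intro b
    rw [hamFraction_algebraMap_left, hamExtend_algebraMap, P.bracket_self, map_zero]
  have h1 := hB a
  simp only at hs
  rw [← hs, hamFraction_mul, Derivation.leibniz, Derivation.leibniz, hB,
    P.hamFraction_skew _ x] at h1
  have h2 : algebraMap B (FractionRing B) s * (algebraMap B (FractionRing B) s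
      * P.hamFraction x x) = 0 := by
    simp only [smul_eq_mul] at h1
    linear_combination h1
  simpa [h0] using h2

/-- The Poisson structure on the fraction field of an integral Poisson algebra which extends the
one of the algebra (see `fraction_algebraMap`, and `fraction_unique` for uniqueness). -/
noncomputable def fraction (P : PoissonStructure R B) : PoissonStructure R (FractionRing B) where
  bracket :=
    { toFun := fun x => (P.hamFraction x : FractionRing B →ₗ[R] FractionRing B)
      map_add' := fun x y => by ext z; simp
      map_smul' := fun r x => by ext z; simp }
  bracket_self := P.hamFraction_self
  jacobi := by
    refine jacobi_of_derivation P.hamFraction P.hamFraction_self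
      (Set.range (algebraMap B (FractionRing B))) (fun D hD => derivation_fraction_ext hD) ?_
    rintro _ ⟨a, rfl⟩ _ ⟨b, rfl⟩ _ ⟨c, rfl⟩
    simp only [hamFraction_algebraMap_left, hamExtend_algebraMap, ← map_add, P.jacobi, map_zero]
  leibniz := fun a b c => by
    change P.hamFraction a (b * c) = P.hamFraction a b * c + b * P.hamFraction a c
    rw [Derivation.leibniz, smul_eq_mul, smul_eq_mul]
    ring

theorem fraction_algebraMap (P : PoissonStructure R B) (a b : B) :
    P.fraction.bracket (algebraMap B (FractionRing B) a) (algebraMap B (FractionRing B) b)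
      = algebraMap B (FractionRing B) (P.bracket a b) := by
  change P.hamFraction _ _ = _
  rw [hamFraction_algebraMap_left, hamExtend_algebraMap]

theorem fraction_unique (P : PoissonStructure R B) (Q : PoissonStructure R (FractionRing B))
    (h : ∀ a b : B, Q.bracket (algebraMap B (FractionRing B) a) (algebraMap B (FractionRing B) b)
      = algebraMap B (FractionRing B) (P.bracket a b)) (x y : FractionRing B) :
    Q.bracket x y = P.fraction.bracket x y := by
  have h1 : ∀ (a : B) (z : FractionRing B), Q.bracket (algebraMap B _ a) z
      = P.fraction.bracket (algebraMap B _ a) z := by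
    intro a z
    have : Q.ham (algebraMap B _ a) - P.fraction.ham (algebraMap B _ a) = 0 := by
      apply derivation_fraction_ext
      rintro _ ⟨b, rfl⟩
      simp [h, fraction_algebraMap]
    exact sub_eq_zero.mp (congrArg (fun D => D z) this)
  have : Q.ham x - P.fraction.ham x = 0 := by
    apply derivation_fraction_ext
    rintro _ ⟨b, rfl⟩
    rw [Derivation.sub_apply, ham_apply, ham_apply, Q.skew, P.fraction.skew, h1, sub_self]
  exact sub_eq_zero.mp (congrArg (fun D => D y) this)

end Fraction

/-! ### The Poisson structure on a tensor power -/

section TensorPower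

variable {R A : Type*} [CommRing R] [CommRing A] [Algebra R A] {n : ℕ}

/-- The bilinear bracket of `A^{⊗n}`:
`{a₁ ⊗ ⋯ ⊗ aₙ, b₁ ⊗ ⋯ ⊗ bₙ} = ∑ᵢ a₁b₁ ⊗ ⋯ ⊗ {aᵢ, bᵢ} ⊗ ⋯ ⊗ aₙbₙ`. -/
noncomputable def tensorBracket (P : PoissonStructure R A) (n : ℕ) :
    (⨂[R] _ : Fin n, A) →ₗ[R] (⨂[R] _ : Fin n, A) →ₗ[R] (⨂[R] _ : Fin n, A) :=
  ∑ i : Fin n, PiTensorProduct.map₂ (fun j => if j = i then P.bracket else LinearMap.mul R A)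

theorem tensorBracket_tprod (P : PoissonStructure R A) (a b : Fin n → A) :
    P.tensorBracket n (PiTensorProduct.tprod R a) (PiTensorProduct.tprod R b)
      = ∑ i, PiTensorProduct.tprod R (fun j => if j = i then P.bracket (a j) (b j) else a j * b j) := by
  simp only [tensorBracket, LinearMap.sum_apply, PiTensorProduct.map₂_tprod_tprod]
  refine Finset.sum_congr rfl fun i _ => congrArg _ (funext fun j => ?_)
  split_ifs <;> simp

theorem tprod_eq_zero_of_apply {a : Fin n → A} {i : Fin n} (h : a i = 0) :
    PiTensorProduct.tprod R a = 0 := (PiTensorProduct.tprod R).map_coord_zero i h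

theorem tensorBracket_skew (P : PoissonStructure R A) (x y : ⨂[R] _ : Fin n, A) :
    P.tensorBracket n x y = -P.tensorBracket n y x := by
  induction x using PiTensorProduct.induction_on with
  | add x x' hx hx' => simp [hx, hx']; abel
  | smul_tprod r a =>
    induction y using PiTensorProduct.induction_on with
    | add y y' hy hy' => simp only [map_add, LinearMap.add_apply, hy, hy']; abel
    | smul_tprod s b =>
      simp only [map_smul, LinearMap.smul_apply, tensorBracket_tprod]
      rw [smul_comm, ← smul_neg, ← smul_neg, ← Finset.sum_neg_distrib]
      congr 2
      refine Finset.sum_congr rfl fun i _ => ?_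
      have h1 : (fun j => if j = i then P.bracket (a j) (b j) else a j * b j)
          = Function.update (fun j => a j * b j) i (-P.bracket (b i) (a i)) := by
        ext j
        by_cases h : j = i
        · subst h; simp [← P.skew]
        · simp [h]
      have h2 : (fun j => if j = i then P.bracket (b j) (a j) else b j * a j)
          = Function.update (fun j => a j * b j) i (P.bracket (b i) (a i)) := by
        ext j
        by_cases h : j = i
        · subst h; simp
        · simp [h, mul_comm]
      rw [h1, h2, MultilinearMap.map_update_neg]

theorem tensorBracket_self (P : PoissonStructure R A) (x : ⨂[R] _ : Fin n, A) :
    P.tensorBracket n x x = 0 := by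
  induction x using PiTensorProduct.induction_on with
  | add x y hx hy =>
    simp only [map_add, LinearMap.add_apply, hx, hy, zero_add, add_zero]
    rw [P.tensorBracket_skew x y]
    simp
  | smul_tprod r a =>
    simp only [map_smul, LinearMap.smul_apply, tensorBracket_tprod]
    rw [Finset.sum_eq_zero, smul_zero, smul_zero]
    intro i _
    exact tprod_eq_zero_of_apply (i := i) (by simp [P.bracket_self])

theorem tensorBracket_leibniz (P : PoissonStructure R A) (x y z : ⨂[R] _ : Fin n, A) :
    P.tensorBracket n x (y * z)
      = P.tensorBracket n x y * z + y * P.tensorBracket n x z := by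
  induction x using PiTensorProduct.induction_on with
  | add x x' hx hx' => simp only [map_add, LinearMap.add_apply, hx, hx']; ring
  | smul_tprod r a =>
  induction y using PiTensorProduct.induction_on with
  | add y y' hy hy' => simp only [add_mul, map_add, hy, hy']; ring
  | smul_tprod s b =>
  induction z using PiTensorProduct.induction_on with
  | add z z' hz hz' => simp only [mul_add, map_add, hz, hz']; ring
  | smul_tprod t c =>
  simp only [map_smul, LinearMap.smul_apply, smul_mul_assoc, mul_smul_comm,
    PiTensorProduct.tprod_mul_tprod, tensorBracket_tprod, Finset.sum_mul, Finset.mul_sum,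
    Finset.smul_sum]
  rw [← Finset.sum_add_distrib]
  refine Finset.sum_congr rfl fun i _ => ?_
  have h1 : (fun j => if j = i then P.bracket (a j) ((b * c) j) else a j * (b * c) j)
      = Function.update (fun j => a j * b j * c j) i
        (P.bracket (a i) (b i) * c i + b i * P.bracket (a i) (c i)) := by
    ext j
    by_cases h : j = i
    · subst h; simp [P.leibniz]
    · simp [h, mul_assoc]
  have h2 : (fun j => if j = i then P.bracket (a j) (b j) else a j * b j) * c
      = Function.update (fun j => a j * b j * c j) i (P.bracket (a i) (b i) * c i) := by
    ext j
    by_cases h : j = i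
    · subst h; simp
    · simp [h]
  have h3 : (b * fun j => if j = i then P.bracket (a j) (c j) else a j * c j)
      = Function.update (fun j => a j * b j * c j) i (b i * P.bracket (a i) (c i)) := by
    ext j
    by_cases h : j = i
    · subst h; simp
    · simp [h]; ring
  rw [h1, h2, h3, MultilinearMap.map_update_add]
  simp only [smul_add, smul_smul]
  congr 2
  all_goals ring

/-- The element `1 ⊗ ⋯ ⊗ a ⊗ ⋯ ⊗ 1` with `a` in position `i`. -/
noncomputable def single (R : Type*) {A : Type*} [CommRing R] [CommRing A] [Algebra R A] {n : ℕ}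
    (i : Fin n) (a : A) : ⨂[R] _ : Fin n, A :=
  PiTensorProduct.singleAlgHom (R := R) (A := fun _ : Fin n => A) i a

theorem tprod_eq_prod_single (a : Fin n → A) :
    PiTensorProduct.tprod R a = ∏ i, single R i (a i) := by
  simp only [single, PiTensorProduct.singleAlgHom_apply]
  rw [← PiTensorProduct.tprod_prod]
  congr 1
  exact (Finset.univ_prod_mulSingle a).symm

theorem tensorBracket_single (P : PoissonStructure R A) (i j : Fin n) (a b : A) :
    P.tensorBracket n (single R i a) (single R j b)
      = if i = j then single R i (P.bracket a b) else 0 := by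
  have hone : ∀ c, P.bracket c 1 = 0 := by
    intro c
    have := P.leibniz c 1 1
    simpa using this
  have hone' : ∀ c, P.bracket 1 c = 0 := by
    intro c
    rw [P.skew, hone, neg_zero]
  simp only [single, PiTensorProduct.singleAlgHom_apply, tensorBracket_tprod,
    MonoidHom.mulSingle_apply]
  split_ifs with h
  · subst h
    rw [Finset.sum_eq_single i]
    · congr 1
      ext l
      by_cases hl : l = i
      · subst hl; simp
      · simp [hl]
    · intro l _ hl
      exact tprod_eq_zero_of_apply (i := l) (by simp [hl, hone])
    · simp
  · refine Finset.sum_eq_zero fun l _ => ?_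
    by_cases hl : l = i
    · subst hl
      exact tprod_eq_zero_of_apply (i := l) (by simp [h, hone])
    · exact tprod_eq_zero_of_apply (i := l) (by simp [hl, hone'])

theorem derivation_tensor_ext {D : Derivation R (⨂[R] _ : Fin n, A) (⨂[R] _ : Fin n, A)}
    (h : ∀ x ∈ Set.range (fun p : Fin n × A => single R p.1 p.2), D x = 0) : D = 0 := by
  have hp : ∀ (s : Finset (Fin n)) (a : Fin n → A), D (∏ i ∈ s, single R i (a i)) = 0 := by
    intro s a
    induction s using Finset.induction_on with
    | empty => simp
    | insert i s hi ih =>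
      rw [Finset.prod_insert hi, Derivation.leibniz, ih, h _ ⟨(i, a i), rfl⟩]
      simp
  ext x
  induction x using PiTensorProduct.induction_on with
  | add x y hx hy => rw [map_add, hx, hy]; simp
  | smul_tprod r a =>
    have := D.map_smul r (PiTensorProduct.tprod R a)
    rw [tprod_eq_prod_single, hp, smul_zero] at this
    rw [tprod_eq_prod_single]
    exact this

/-- The Poisson structure on `A^{⊗n}`. -/
noncomputable def tensorPower (P : PoissonStructure R A) (n : ℕ) :
    PoissonStructure R (⨂[R] _ : Fin n, A) where
  bracket := P.tensorBracket n
  bracket_self := P.tensorBracket_self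
  jacobi := by
    let β : (⨂[R] _ : Fin n, A) →ₗ[R]
        Derivation R (⨂[R] _ : Fin n, A) (⨂[R] _ : Fin n, A) :=
      { toFun := fun x => Derivation.mk' (P.tensorBracket n x) (by
          intro y z
          rw [P.tensorBracket_leibniz, smul_eq_mul, smul_eq_mul,
            mul_comm (P.tensorBracket n x y) z, add_comm])
        map_add' := fun x y => by ext z; simp
        map_smul' := fun r x => by ext z; simp }
    refine jacobi_of_derivation β P.tensorBracket_self
      (Set.range (fun p : Fin n × A => single R p.1 p.2))
      (fun D hD => derivation_tensor_ext hD) ?_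
    have hβ : ∀ x y, β x y = P.tensorBracket n x y := fun _ _ => rfl
    rintro _ ⟨⟨i, a⟩, rfl⟩ _ ⟨⟨j, b⟩, rfl⟩ _ ⟨⟨l, c⟩, rfl⟩
    simp only [hβ, tensorBracket_single]
    by_cases hij : i = j
    · subst hij
      by_cases hil : i = l
      · subst hil
        simp only [if_true, tensorBracket_single]
        simp only [single, ← map_add, P.jacobi, map_zero]
      · simp [hil, Ne.symm hil, tensorBracket_single]
    · by_cases hil : i = l
      · subst hil
        simp [hij, Ne.symm hij, tensorBracket_single]
      · by_cases hjl : j = l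
        · subst hjl
          simp [hij, Ne.symm hij, tensorBracket_single]
        · simp [hij, hjl, Ne.symm hil]
  leibniz := P.tensorBracket_leibniz

end TensorPower

end PoissonStructure

/-! ### Quantizations -/

/-- A `k[[ħ]]`-module `M` is topologically free if it is isomorphic to `V[[ħ]]` for some `k`-vector
space `V`. A series `∑ vₘ ħᵐ` in `V[[ħ]]` is given by its sequence of coefficients, and `k[[ħ]]`
acts on these sequences by the Cauchy product. -/
def IsTopologicallyFree (k : Type u) (M : Type w) [Field k] [AddCommGroup M]
    [Module (PowerSeries k) M] : Prop :=
  ∃ (V : Type w) (_ : AddCommGroup V) (_ : Module k V) (e : M ≃+ (ℕ → V)),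
    ∀ (c : PowerSeries k) (x : M) (m : ℕ),
      e (c • x) m = ∑ p ∈ Finset.HasAntidiagonal.antidiagonal m, PowerSeries.coeff p.1 c • e x p.2

/-- `H` is a quantization of the Poisson algebra `B`: an associative unital `k[[ħ]]`-algebra,
topologically free as a `k[[ħ]]`-module, together with an isomorphism of `k`-algebras
`H / ħ H ≃ B` (given here by the projection `H → B`), such that the bracket
`{x mod ħ, y mod ħ} = ħ⁻¹ (x y - y x) mod ħ` is the Poisson bracket of `B`. -/
structure Quantization {k : Type u} {B : Type v} [Field k] [CommRing B] [Algebra k B]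
    (P : PoissonStructure k B) (H : Type w) [Ring H] [Algebra (PowerSeries k) H] where
  topologicallyFree : IsTopologicallyFree k H
  proj : H →+* B
  proj_smul : ∀ (c : PowerSeries k) (x : H),
    proj (c • x) = PowerSeries.constantCoeff c • proj x
  proj_surjective : Function.Surjective proj
  proj_eq_zero_iff : ∀ x : H, proj x = 0 ↔ ∃ y : H, x = (PowerSeries.X : PowerSeries k) • y
  commutator : ∀ x y z : H, x * y - y * x = (PowerSeries.X : PowerSeries k) • z →
    P.bracket (proj x) (proj y) = proj z

/-- A quantization of a family `h` of elements of a Poisson algebra `K`: a quantization of `K`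
together with pairwise commuting elements of it which deform (that is, lift) the elements of the
family. -/
structure FamilyQuantization {k : Type u} {K : Type v} [Field k] [CommRing K] [Algebra k K]
    (P : PoissonStructure k K) {ι : Type*} (h : ι → K)
    (H : Type w) [Ring H] [Algebra (PowerSeries k) H] extends Quantization P H where
  lift : ι → H
  lift_commute : ∀ i j, Commute (lift i) (lift j)
  proj_lift : ∀ i, proj (lift i) = h i

/-! ### The classical family -/

section ClassicalFamily

variable (k : Type u) {A : Type v} [Field k] [CommRing A] [Algebra k A] {n : ℕ}

/-- `[g₁, …, gₙ] = ∑_σ ε(σ) g_{σ(1)} ⊗ ⋯ ⊗ g_{σ(n)}` in `A^{⊗n}`. -/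
noncomputable def antisymTensor (g : Fin n → A) : ⨂[k] _ : Fin n, A :=
  ∑ σ : Equiv.Perm (Fin n),
    (Equiv.Perm.sign σ : ℤ) • PiTensorProduct.tprod k (fun j => g (σ j))

/-- `Δᵢ = [f₀, …, f̌ᵢ, …, fₙ]`. -/
noncomputable def classicalDelta (f : Fin (n + 1) → A) (i : Fin (n + 1)) : ⨂[k] _ : Fin n, A :=
  antisymTensor k (fun j => f (i.succAbove j))

/-- `hᵢ = Δᵢ / Δ₀` for `i = 1, …, n` (the index `i : Fin n` stands for `i + 1`). -/
noncomputable def classicalFamily [IsDomain (⨂[k] _ : Fin n, A)] (f : Fin (n + 1) → A)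
    (i : Fin n) : FractionRing (⨂[k] _ : Fin n, A) :=
  algebraMap _ (FractionRing (⨂[k] _ : Fin n, A)) (classicalDelta k f i.succ) /
    algebraMap _ (FractionRing (⨂[k] _ : Fin n, A)) (classicalDelta k f 0)

end ClassicalFamily

/-!
The sign-corrected functions `uᵢ = (-1)ⁱ hᵢ` solve the linear system
`∑ᵢ fᵢ⁽ʲ⁾ uᵢ = -f₀⁽ʲ⁾` for `j = 1, …, n`, where `f⁽ʲ⁾` is `f` placed in the `j`-th tensor factor:
this is the Laplace expansion of a determinant with two equal columns
(`sum_single_mul_classicalDelta`).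
Its determinant `Δ₀` is nonzero, as one sees by applying the functionals dual to `f₁, …, fₙ` to the
tensor factors (`antisymTensor_ne_zero`). The quantized family is, up to the same signs, the
solution of the same system with `fᵢ⁽ʲ⁾` replaced by lifts to a quantization of the fraction field.

*The solution commutes.* Let `M x = V` be a linear system over an `ħ`-complete quantization in which
entries taken from different rows commute, with `M` invertible modulo `ħ`. For `i ≠ i'` both
`∑ Mᵢⱼ Mᵢ'ₗ xⱼ xₗ` and `∑ Mᵢⱼ Mᵢ'ₗ xₗ xⱼ` equal `Vᵢ Vᵢ'`, so the alternating matrix of commutators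
`cⱼₗ = [xⱼ, xₗ]` satisfies `∑ Mᵢⱼ Mᵢ'ₗ cⱼₗ = 0` for `i ≠ i'`. Modulo `ħ` the same holds for
`i = i'`, since the coefficients commute there and `c` is alternating. Hence
`M c Mᵀ = 0` modulo `ħ`, so `c` is
divisible by `ħ`; the quotient satisfies the same equations, and so `c = 0` by separatedness
(`Quantization.commute_of_mulVec_eq`). The solution itself is constructed order by order in `ħ`
(`Quantization.exists_mulVec_eq`).

*The quantization of the fraction field.* The tensor power `A_ħ^{⊗n}` over `k[[ħ]]` need not be
complete, but it is flat, hence without `ħ`-torsion, and it reduces to `A^{⊗n}` modulo `ħ`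
(`PreQuantization.exists_tensorPower`). For any torsion-free `H` whose reduction `B` is a domain,
let `S` be the set of elements which are nonzero modulo `ħ`. As `ad s` is divisible by `ħ`,
the element `sᵐ a` is a left multiple of `s` modulo `ħᵐ`. So the image of `S` in `H / ħᵐ H` is an
Ore set, and
the limit over `m` of the localizations of `H / ħᵐ H` is `ħ`-complete with reduction `Frac B`
(`PreQuantization.completeLocalizationQuantization`). Its commutator induces the Poisson bracket of
`Frac B` because the pairs for which this is true (`QuantizedPair`) are stable under sums, products,
inverses, and addition of multiples of `ħ`.
-/

/-! ### Complete and topologically free modules -/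

section Complete

/-- A `k[[ħ]]`-module is `ħ`-complete if it has no `ħ`-torsion, is separated for the `ħ`-adic
topology, and every series `∑ ħⁱ aᵢ` converges in it. -/
structure HbarComplete (k : Type*) (M : Type*) [Field k] [AddCommGroup M]
    [Module (PowerSeries k) M] : Prop where
  eq_zero_of_X_smul : ∀ x : M, (PowerSeries.X : PowerSeries k) • x = 0 → x = 0
  separated : ∀ x : M, (∀ m : ℕ, ∃ y, x = (PowerSeries.X : PowerSeries k) ^ m • y) → x = 0
  complete : ∀ a : ℕ → M, ∃ x, ∀ m : ℕ, ∃ y,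
    x = ∑ i ∈ Finset.range m, (PowerSeries.X : PowerSeries k) ^ i • a i
      + (PowerSeries.X : PowerSeries k) ^ m • y

theorem IsTopologicallyFree.eq_zero_of_X_smul {k : Type u} {M : Type w} [Field k] [AddCommGroup M]
    [Module (PowerSeries k) M] (h : IsTopologicallyFree k M) (x : M)
    (hx : (PowerSeries.X : PowerSeries k) • x = 0) : x = 0 := by
  obtain ⟨V, _, _, e, he⟩ := h
  apply e.injective
  ext m
  have h1 := he PowerSeries.X x (m + 1)
  rw [hx, Finset.sum_eq_single (1, m)] at h1
  · simpa using h1.symm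
  · rintro ⟨p, q⟩ hpq hne
    have hp : p ≠ 1 := by
      rintro rfl
      rw [Finset.HasAntidiagonal.mem_antidiagonal] at hpq
      exact hne (Prod.ext rfl (by simp only at hpq ⊢; omega))
    simp [PowerSeries.coeff_X, hp]
  · intro h
    exact absurd (Finset.HasAntidiagonal.mem_antidiagonal.mpr (by omega)) h

/-- If `σ` is a section of the reduction `c : M → V` modulo `ħ`, then writing
`x = σ (c x) + ħ (d x)` and iterating gives the coefficients `c (dᵐ x)` of the expansion of `x`. -/
theorem isTopologicallyFree_of_splitting {k : Type u} {M V : Type w} [Field k] [AddCommGroup M]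
    [Module (PowerSeries k) M] [AddCommGroup V] [Module k V] (hM : HbarComplete k M)
    (σ : V →+ M) (c : M →+ V) (hc : ∀ (r : PowerSeries k) x, c (r • x)
      = PowerSeries.constantCoeff r • c x) (hcσ : ∀ v, c (σ v) = v)
    (hσ : ∀ (r : k) v, σ (r • v) = (PowerSeries.C r : PowerSeries k) • σ v)
    (hker : ∀ x, c x = 0 → ∃ y, x = (PowerSeries.X : PowerSeries k) • y) :
    IsTopologicallyFree k M := by
  have hX : ∀ y : M, c ((PowerSeries.X : PowerSeries k) • y) = 0 := fun y => by simp [hc]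
  have hinj : ∀ x y : M, (PowerSeries.X : PowerSeries k) • x = (PowerSeries.X : PowerSeries k) • y
      → x = y := fun x y h =>
    sub_eq_zero.mp (hM.eq_zero_of_X_smul _ (by rw [smul_sub, h, sub_self]))
  have hd : ∀ x, ∃ y, x = σ (c x) + (PowerSeries.X : PowerSeries k) • y := by
    intro x
    obtain ⟨y, hy⟩ := hker (x - σ (c x)) (by rw [map_sub, hcσ, sub_self])
    exact ⟨y, by rw [← hy]; abel⟩
  choose d hd using hd
  -- The expansion `x = σ v + ħ y` is unique.
  have huniq : ∀ x v y, x = σ v + (PowerSeries.X : PowerSeries k) • y → c x = v ∧ d x = y := by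
    intro x v y h
    have h1 : c x = v := by rw [h, map_add, hcσ, hX, add_zero]
    refine ⟨h1, hinj _ _ ?_⟩
    have h2 := hd x
    rw [h1, h] at h2
    rw [h]
    exact (add_left_cancel h2).symm
  have hd_add : ∀ x y, d (x + y) = d x + d y := by
    intro x y
    refine (huniq (x + y) (c x + c y) (d x + d y) ?_).2
    conv_lhs => rw [hd x, hd y]
    rw [map_add, smul_add]; abel
  have hd_smul : ∀ (r : PowerSeries k) x, ∃ r' : PowerSeries k,
      (∀ m, PowerSeries.coeff m r' = PowerSeries.coeff (m + 1) r) ∧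
      d (r • x) = (PowerSeries.C (PowerSeries.constantCoeff r) : PowerSeries k) • d x
        + r' • x := by
    intro r x
    refine ⟨PowerSeries.mk fun m => PowerSeries.coeff (m + 1) r, fun m => by simp, ?_⟩
    refine (huniq (r • x) (PowerSeries.constantCoeff r • c x) _ ?_).2
    conv_lhs => rw [PowerSeries.eq_X_mul_shift_add_const r]
    rw [hσ, add_smul, mul_smul]
    conv_lhs => enter [2]; rw [hd x]
    rw [smul_add, smul_add, smul_comm (PowerSeries.X : PowerSeries k) (PowerSeries.C _)]
    abel
  let E : M → ℕ → V := fun x m => c (d^[m] x)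
  have hE0 : ∀ x, E x 0 = c x := fun _ => rfl
  have hEs : ∀ x m, E x (m + 1) = E (d x) m := fun x m => by simp [E]
  have hE_add : ∀ m x y, E (x + y) m = E x m + E y m := by
    intro m
    induction m with
    | zero => intro x y; simp [hE0]
    | succ m ih => intro x y; rw [hEs, hd_add, ih, hEs, hEs]
  let F : M →+ (ℕ → V) := AddMonoidHom.mk' E fun x y => funext fun m => hE_add m x y
  have hFinj : Function.Injective F := by
    rw [injective_iff_map_eq_zero]
    intro x hx
    refine hM.separated x fun m => ⟨d^[m] x, ?_⟩
    have hx' : ∀ m, E x m = 0 := fun m => congrFun hx m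
    clear hx
    induction m generalizing x with
    | zero => simp
    | succ m ih =>
      have h0 := hx' 0
      rw [hE0] at h0
      conv_lhs => rw [hd x, h0, map_zero, zero_add]
      rw [Function.iterate_succ_apply, pow_succ', mul_smul, ← ih (d x) fun m => by
        rw [← hEs]; exact hx' _]
  have hFsurj : Function.Surjective F := by
    intro v
    obtain ⟨x, hx⟩ := hM.complete fun i => σ (v i)
    have key : ∀ m, ∀ N, ∃ y, d^[m] x = ∑ i ∈ Finset.range N,
        (PowerSeries.X : PowerSeries k) ^ i • σ (v (m + i))
        + (PowerSeries.X : PowerSeries k) ^ N • y := by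
      intro m
      induction m with
      | zero => intro N; simpa using hx N
      | succ m ih =>
        intro N
        obtain ⟨y, hy⟩ := ih (N + 1)
        refine ⟨y, ?_⟩
        rw [Function.iterate_succ_apply']
        refine (huniq _ (v m) _ ?_).2
        rw [hy, Finset.sum_range_succ', pow_succ', mul_smul, smul_add, Finset.smul_sum]
        simp only [pow_succ', mul_smul, pow_zero, one_smul, add_zero]
        simp only [add_comm 1, add_assoc]
        abel
    refine ⟨x, funext fun m => ?_⟩
    obtain ⟨y, hy⟩ := key m 1
    change c (d^[m] x) = v m
    exact (huniq _ _ y (by simpa using hy)).1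
  refine ⟨V, inferInstance, inferInstance, AddEquiv.ofBijective F ⟨hFinj, hFsurj⟩, ?_⟩
  intro r x m
  change E (r • x) m = ∑ p ∈ Finset.HasAntidiagonal.antidiagonal m,
    PowerSeries.coeff p.1 r • E x p.2
  have hC : ∀ m (r : k) x, E ((PowerSeries.C r : PowerSeries k) • x) m = r • E x m := by
    intro m
    induction m with
    | zero => intro r x; simp [hE0, hc]
    | succ m ih =>
      intro r x
      rw [hEs, hEs, ← ih]
      congr 1
      refine (huniq _ (r • c x) _ ?_).2
      conv_lhs => rw [hd x]
      rw [smul_add, hσ, smul_comm]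
  induction m generalizing r x with
  | zero => simp [hE0, hc]
  | succ m ih =>
    obtain ⟨r', hr', h⟩ := hd_smul r x
    rw [hEs, h, hE_add, hC, ih, Finset.Nat.antidiagonal_succ]
    simp [hr', ← hEs]

/-- An `ħ`-complete module is topologically free: it is `V[[ħ]]` for `V = M / ħ M`. -/
theorem HbarComplete.isTopologicallyFree {k : Type u} {M : Type w} [Field k] [AddCommGroup M]
    [Module (PowerSeries k) M] (hM : HbarComplete k M) : IsTopologicallyFree k M := by
  let _ : Module k M := Module.compHom M (PowerSeries.C : k →+* PowerSeries k)
  have hsm : ∀ (r : k) (x : M), r • x = (PowerSeries.C r : PowerSeries k) • x := fun _ _ => rfl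
  let N : Submodule k M :=
    { carrier := {x | ∃ y, x = (PowerSeries.X : PowerSeries k) • y}
      add_mem' := by
        rintro _ _ ⟨a, rfl⟩ ⟨b, rfl⟩
        exact ⟨a + b, (smul_add _ _ _).symm⟩
      zero_mem' := ⟨0, (smul_zero _).symm⟩
      smul_mem' := by
        rintro r _ ⟨a, rfl⟩
        exact ⟨r • a, by rw [hsm, hsm, smul_comm]⟩ }
  obtain ⟨σ, hσ⟩ := N.mkQ.exists_rightInverse_of_surjective N.range_mkQ
  refine isTopologicallyFree_of_splitting hM σ.toAddMonoidHom N.mkQ.toAddMonoidHom ?_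
    (fun v => LinearMap.congr_fun hσ v) (fun r v => by rw [← hsm]; exact σ.map_smul r v)
    (fun x hx => (Submodule.Quotient.mk_eq_zero N).mp hx)
  intro r x
  change N.mkQ (r • x) = PowerSeries.constantCoeff r • N.mkQ x
  rw [← map_smul, ← sub_eq_zero, ← map_sub]
  refine (Submodule.Quotient.mk_eq_zero N).mpr
    ⟨(PowerSeries.mk fun p => PowerSeries.coeff (p + 1) r) • x, ?_⟩
  rw [hsm, ← sub_smul, ← mul_smul]
  congr 1
  exact PowerSeries.sub_const_eq_X_mul_shift r

end Complete

/-! ### Torsion-free deformations and their commutators -/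

section Pairs

variable {k : Type*} {B : Type*} {H : Type*} [Field k] [CommRing B] [Algebra k B]
  [Ring H] [Algebra (PowerSeries k) H]

/-- A quantization of a Poisson algebra, with topological freeness weakened to the absence of
`ħ`-torsion. -/
structure PreQuantization (P : PoissonStructure k B) (H : Type*) [Ring H]
    [Algebra (PowerSeries k) H] where
  eq_zero_of_X_smul : ∀ x : H, (PowerSeries.X : PowerSeries k) • x = 0 → x = 0
  proj : H →+* B
  proj_smul : ∀ (c : PowerSeries k) (x : H),
    proj (c • x) = PowerSeries.constantCoeff c • proj x
  proj_surjective : Function.Surjective proj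
  proj_eq_zero_iff : ∀ x : H, proj x = 0 ↔ ∃ y : H, x = (PowerSeries.X : PowerSeries k) • y
  commutator : ∀ x y z : H, x * y - y * x = (PowerSeries.X : PowerSeries k) • z →
    P.bracket (proj x) (proj y) = proj z

/-- The commutator of `x` and `y` is divisible by `ħ`, and `ħ⁻¹ (x y - y x)` reduces to the bracket
of the reductions. -/
def QuantizedPair (P : PoissonStructure k B) (π : H →+* B) (x y : H) : Prop :=
  ∃ z, x * y - y * x = (PowerSeries.X : PowerSeries k) • z ∧ P.bracket (π x) (π y) = π z

namespace QuantizedPair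

variable {P : PoissonStructure k B} {π : H →+* B} {x y z : H}

theorem symm (h : QuantizedPair P π x y) : QuantizedPair P π y x := by
  obtain ⟨z, h1, h2⟩ := h
  exact ⟨-z, by rw [smul_neg, ← h1, neg_sub], by rw [P.skew, h2, map_neg]⟩

theorem add_right (h : QuantizedPair P π x y) (h' : QuantizedPair P π x z) :
    QuantizedPair P π x (y + z) := by
  obtain ⟨a, h1, h2⟩ := h
  obtain ⟨b, h3, h4⟩ := h'
  refine ⟨a + b, ?_, by rw [map_add, map_add, map_add, h2, h4]⟩
  rw [smul_add, ← h1, ← h3]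
  noncomm_ring

theorem mul_right (h : QuantizedPair P π x y) (h' : QuantizedPair P π x z) :
    QuantizedPair P π x (y * z) := by
  obtain ⟨a, h1, h2⟩ := h
  obtain ⟨b, h3, h4⟩ := h'
  refine ⟨a * z + y * b, ?_, by rw [map_mul, P.leibniz, map_add, map_mul, map_mul, h2, h4]⟩
  rw [smul_add, ← smul_mul_assoc, ← mul_smul_comm, ← h1, ← h3]
  noncomm_ring

theorem smul_right (hπ : ∀ (c : PowerSeries k) (x : H),
      π (c • x) = PowerSeries.constantCoeff c • π x)
    (c : PowerSeries k) (h : QuantizedPair P π x y) : QuantizedPair P π x (c • y) := by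
  obtain ⟨z, h1, h2⟩ := h
  refine ⟨c • z, ?_, by rw [hπ, hπ, map_smul, h2]⟩
  rw [smul_comm, ← h1, mul_smul_comm, smul_mul_assoc, smul_sub]

theorem of_commute (h : Commute x y) (h0 : P.bracket (π x) (π y) = 0) : QuantizedPair P π x y :=
  ⟨0, by rw [h.eq, sub_self, smul_zero], by rw [h0, map_zero]⟩

theorem one_right (x : H) : QuantizedPair P π x 1 := by
  refine of_commute (Commute.one_right x) ?_
  rw [map_one]
  simpa using P.leibniz (π x) 1 1

theorem X_smul_right (hπ : ∀ (c : PowerSeries k) (x : H),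
      π (c • x) = PowerSeries.constantCoeff c • π x) (x y : H) :
    QuantizedPair P π x ((PowerSeries.X : PowerSeries k) • y) := by
  have h : ∀ z : H, π ((PowerSeries.X : PowerSeries k) • z) = 0 := fun z => by simp [hπ]
  refine ⟨x * y - y * x, by rw [smul_sub, mul_smul_comm, smul_mul_assoc], ?_⟩
  rw [h, map_zero, map_sub, map_mul, map_mul, mul_comm, sub_self]

theorem inv_right {u v : H} (h : QuantizedPair P π x u) (huv : u * v = 1) (hvu : v * u = 1) :
    QuantizedPair P π x v := by
  obtain ⟨z, h1, h2⟩ := h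
  have e : π u * π v = 1 := by rw [← map_mul, huv, map_one]
  have e1 : P.bracket (π x) 1 = 0 := by simpa using P.leibniz (π x) 1 1
  refine ⟨-(v * z * v), ?_, ?_⟩
  · rw [smul_neg, ← smul_mul_assoc, ← mul_smul_comm, ← h1]
    have : v * (x * u - u * x) * v = v * x * (u * v) - (v * u) * x * v := by noncomm_ring
    rw [this, huv, hvu]
    noncomm_ring
  · have h3 := P.leibniz (π x) (π u) (π v)
    rw [e, e1, h2] at h3
    rw [map_neg, map_mul, map_mul]
    linear_combination (-P.bracket (π x) (π v)) * e - π v * h3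

end QuantizedPair

theorem PreQuantization.quantizedPair {P : PoissonStructure k B} (D : PreQuantization P H)
    (x y : H) : QuantizedPair P D.proj x y := by
  obtain ⟨z, hz⟩ := (D.proj_eq_zero_iff (x * y - y * x)).mp (by simp [mul_comm])
  exact ⟨z, hz, D.commutator x y z hz⟩

/-- Without `ħ`-torsion the quotient `ħ⁻¹ (x y - y x)` is unique. -/
theorem QuantizedPair.commutator {P : PoissonStructure k B} {π : H →+* B}
    (h0 : ∀ x : H, (PowerSeries.X : PowerSeries k) • x = 0 → x = 0) {x y : H}
    (h : QuantizedPair P π x y) (z : H)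
    (hz : x * y - y * x = (PowerSeries.X : PowerSeries k) • z) :
    P.bracket (π x) (π y) = π z := by
  obtain ⟨z', h1, h2⟩ := h
  rw [h2, sub_eq_zero.mp (h0 (z - z') (by rw [smul_sub, ← hz, ← h1, sub_self]))]

end Pairs

/-! ### Deformation of a tensor power -/

section TensorFlat

theorem PowerSeries.isTorsionFree_of_X_smul {k M : Type*} [Field k] [AddCommGroup M]
    [Module (PowerSeries k) M]
    (h : ∀ x : M, (PowerSeries.X : PowerSeries k) • x = 0 → x = 0) :
    Module.IsTorsionFree (PowerSeries k) M := by
  have hpow : ∀ (m : ℕ) (x : M), (PowerSeries.X : PowerSeries k) ^ m • x = 0 → x = 0 := by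
    intro m
    induction m with
    | zero => intro x hx; simpa using hx
    | succ m ih =>
      intro x hx
      rw [pow_succ', mul_smul] at hx
      exact ih x (h _ hx)
  refine ⟨fun r hr x y hxy => sub_eq_zero.mp ?_⟩
  have hr0 : r ≠ 0 := hr.ne_zero
  have h0 : r • (x - y) = 0 := by rw [smul_sub]; exact sub_eq_zero.mpr hxy
  rw [← PowerSeries.X_pow_order_mul_divXPowOrder (f := r), mul_smul] at h0
  exact (PowerSeries.isUnit_divided_by_X_pow_order hr0).smul_eq_zero.mp (hpow _ _ h0)

theorem PiTensorProduct.flat_fin {R M : Type*} [CommRing R] [AddCommGroup M] [Module R M]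
    [Module.Flat R M] (n : ℕ) : Module.Flat R (⨂[R] _ : Fin n, M) := by
  induction n with
  | zero => exact Module.Flat.of_linearEquiv (PiTensorProduct.isEmptyEquiv (Fin 0))
  | succ n ih =>
    have h1 : Module.Flat R (⨂[R] _ : Fin 1, M) :=
      Module.Flat.of_linearEquiv (PiTensorProduct.subsingletonEquiv (0 : Fin 1))
    exact Module.Flat.of_linearEquiv ((PiTensorProduct.tmulEquiv R M).trans
      (PiTensorProduct.reindex R (fun _ => M) finSumFinEquiv)).symm

end TensorFlat

section TensorReduction

variable {k : Type*} {A H : Type*} [Field k] [CommRing A] [Algebra k A]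
  [Ring H] [Algebra (PowerSeries k) H]

/-- The reduction `H^{⊗n} → A^{⊗n}` induced by a reduction `p : H → A`; the tensor powers are taken
over `k[[ħ]]` and over `k` respectively. -/
theorem PiTensorProduct.exists_reduction {n : ℕ} (p : H →+* A)
    (hp : ∀ (c : PowerSeries k) (x : H), p (c • x) = PowerSeries.constantCoeff c • p x) :
    ∃ π : (⨂[PowerSeries k] _ : Fin n, H) →+* (⨂[k] _ : Fin n, A),
      (∀ a : Fin n → H, π (PiTensorProduct.tprod _ a) = PiTensorProduct.tprod k fun i => p (a i)) ∧
      ∀ (c : PowerSeries k) x, π (c • x) = PowerSeries.constantCoeff c • π x := by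
  let _ : Algebra (PowerSeries k) (⨂[k] _ : Fin n, A) :=
    ((algebraMap k (⨂[k] _ : Fin n, A)).comp
      (PowerSeries.constantCoeff : PowerSeries k →+* k)).toAlgebra
  have hsm : ∀ (c : PowerSeries k) (x : ⨂[k] _ : Fin n, A),
      c • x = PowerSeries.constantCoeff c • x := by
    intro c x
    rw [Algebra.smul_def, Algebra.smul_def]
    rfl
  let φ : MultilinearMap (PowerSeries k) (fun _ : Fin n => H) (⨂[k] _ : Fin n, A) :=
    { toFun := fun a => PiTensorProduct.tprod k fun i => p (a i)
      map_update_add' := by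
        intro _ a i x y
        simp only [Function.apply_update (fun _ => p), map_add, MultilinearMap.map_update_add]
      map_update_smul' := by
        intro _ a i c x
        simp only [Function.apply_update (fun _ => p), hp, hsm, MultilinearMap.map_update_smul] }
  let Φ := PiTensorProduct.liftAlgHom φ
    (by
      change PiTensorProduct.tprod k (fun i => p 1) = 1
      rw [map_one]; rfl)
    (by
      intro x y
      change PiTensorProduct.tprod k (fun i => p (x i * y i)) = PiTensorProduct.tprod k _ *
        PiTensorProduct.tprod k _
      rw [PiTensorProduct.tprod_mul_tprod]
      simp only [map_mul]; rfl)
  refine ⟨Φ, fun a => ?_, fun c x => ?_⟩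
  · exact PiTensorProduct.lift.tprod (φ := φ) a
  · rw [← hsm]
    exact Φ.toLinearMap.map_smul c x

/-- A multilinear map into a module killed by `r` only depends on its arguments modulo `r`. -/
theorem MultilinearMap.congr_of_eq_add_smul {R M N : Type*} [CommRing R] [AddCommGroup M]
    [Module R M] [AddCommGroup N] [Module R N] {n : ℕ}
    (g : MultilinearMap R (fun _ : Fin n => M) N) (r : R)
    (hr : ∀ x : N, r • x = 0) (a b : Fin n → M) (h : ∀ i, ∃ y, a i = b i + r • y) : g a = g b := by
  have key : ∀ s : Finset (Fin n), g (s.piecewise a b) = g b := by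
    intro s
    induction s using Finset.induction_on with
    | empty => simp
    | insert i s hi ih =>
      obtain ⟨y, hy⟩ := h i
      rw [Finset.piecewise_insert, hy, g.map_update_add, g.map_update_smul, hr, add_zero]
      rw [← ih]
      congr 1
      ext j
      by_cases hj : j = i
      · subst hj; simp [hi]
      · simp [hj]
  simpa using key Finset.univ

/-- The kernel of the reduction `π : H^{⊗n} → A^{⊗n}` is `ħ H^{⊗n}`: a linear section of `H → A`
induces a map `A^{⊗n} → H^{⊗n} / ħ H^{⊗n}` whose composition with `π` is the quotient map. -/
theorem PiTensorProduct.exists_of_reduction_eq_zero {n : ℕ} (p : H →+* A)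
    (hp : ∀ (c : PowerSeries k) (x : H), p (c • x) = PowerSeries.constantCoeff c • p x)
    (hps : Function.Surjective p)
    (hp0 : ∀ x, p x = 0 → ∃ y : H, x = (PowerSeries.X : PowerSeries k) • y)
    (π : (⨂[PowerSeries k] _ : Fin n, H) →+* (⨂[k] _ : Fin n, A))
    (hπ : ∀ a : Fin n → H,
      π (PiTensorProduct.tprod _ a) = PiTensorProduct.tprod k fun i => p (a i))
    (hπs : ∀ (c : PowerSeries k) x, π (c • x) = PowerSeries.constantCoeff c • π x)
    (x : ⨂[PowerSeries k] _ : Fin n, H) (hx : π x = 0) :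
    ∃ y, x = (PowerSeries.X : PowerSeries k) • y := by
  -- A `k`-linear section `s` of `p`.
  let _ : Module k H := Module.compHom H (PowerSeries.C : k →+* PowerSeries k)
  have hsm : ∀ (r : k) (x : H), r • x = (PowerSeries.C r : PowerSeries k) • x := fun _ _ => rfl
  let pl : H →ₗ[k] A :=
    { toFun := p, map_add' := map_add p, map_smul' := fun r x => by simp [hsm, hp] }
  obtain ⟨s, hs⟩ := pl.exists_rightInverse_of_surjective (LinearMap.range_eq_top.mpr hps)
  have hs' : ∀ a, p (s a) = a := fun a => LinearMap.congr_fun hs a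
  let N : Submodule (PowerSeries k) (⨂[PowerSeries k] _ : Fin n, H) :=
    LinearMap.range (LinearMap.lsmul (PowerSeries k) (⨂[PowerSeries k] _ : Fin n, H) PowerSeries.X)
  let Qt := (⨂[PowerSeries k] _ : Fin n, H) ⧸ N
  have hX : ∀ q : Qt, (PowerSeries.X : PowerSeries k) • q = 0 := by
    intro q
    obtain ⟨y, rfl⟩ := N.mkQ_surjective q
    rw [← map_smul]
    exact (Submodule.Quotient.mk_eq_zero N).mpr ⟨y, rfl⟩
  have hsq : ∀ (r : k) (q : Qt), r • q = (PowerSeries.C r : PowerSeries k) • q :=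
    fun r q => (algebraMap_smul (PowerSeries k) r q).symm
  have hsc : ∀ (c : PowerSeries k) (q : Qt), c • q = PowerSeries.constantCoeff c • q := by
    intro c q
    conv_lhs => rw [PowerSeries.eq_X_mul_shift_add_const c]
    rw [add_smul, mul_smul, hX, zero_add, hsq]
  let g : MultilinearMap (PowerSeries k) (fun _ : Fin n => H) Qt :=
    N.mkQ.compMultilinearMap (PiTensorProduct.tprod _)
  let ψ : MultilinearMap k (fun _ : Fin n => A) Qt :=
    { toFun := fun a => g fun i => s (a i)
      map_update_add' := by
        intro _ a i x y
        simp only [Function.apply_update (fun _ => s), map_add, MultilinearMap.map_update_add]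
      map_update_smul' := by
        intro _ a i r x
        simp only [Function.apply_update (fun _ => s), map_smul]
        simp only [hsm, hsq, MultilinearMap.map_update_smul] }
  have key : ∀ x, PiTensorProduct.lift ψ (π x) = N.mkQ x := by
    intro x
    induction x using PiTensorProduct.induction_on with
    | add x y hx hy => rw [map_add, map_add, hx, hy, map_add]
    | smul_tprod c a =>
      rw [hπs, hπ, map_smul, PiTensorProduct.lift.tprod, map_smul, hsc c]
      congr 1
      refine g.congr_of_eq_add_smul PowerSeries.X hX (fun i => s (p (a i))) a fun i => ?_
      obtain ⟨y, hy⟩ := hp0 (s (p (a i)) - a i) (by rw [map_sub, hs', sub_self])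
      exact ⟨y, by rw [← hy]; abel⟩
  have h0 : N.mkQ x = 0 := by rw [← key, hx, map_zero]
  obtain ⟨y, hy⟩ := (Submodule.Quotient.mk_eq_zero N).mp h0
  exact ⟨y, hy.symm⟩

/-- It suffices to test pairs on the elements `1 ⊗ ⋯ ⊗ b ⊗ ⋯ ⊗ 1`, whose products are the pure
tensors. -/
theorem QuantizedPair.tprod_right {n : ℕ} {B : Type*} [CommRing B] [Algebra k B]
    {P : PoissonStructure k B}
    {π : (⨂[PowerSeries k] _ : Fin n, H) →+* B} (x : ⨂[PowerSeries k] _ : Fin n, H)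
    (h : ∀ i b, QuantizedPair P π x
      (PiTensorProduct.tprod (PowerSeries k) (Pi.mulSingle i b : Fin n → H)))
    (b : Fin n → H) : QuantizedPair P π x (PiTensorProduct.tprod (PowerSeries k) b) := by
  have key : ∀ s : Finset (Fin n), QuantizedPair P π x
      (PiTensorProduct.tprod (PowerSeries k) fun j => if j ∈ s then b j else 1) := by
    intro s
    induction s using Finset.induction_on with
    | empty =>
      simp only [Finset.notMem_empty, if_false]
      exact QuantizedPair.one_right x
    | insert i s hi ih =>
      have e : (fun j => if j ∈ insert i s then b j else 1)
          = (Pi.mulSingle i (b i) : Fin n → H) * fun j => if j ∈ s then b j else 1 := by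
        ext j
        by_cases hj : j = i
        · subst hj; simp [hi]
        · simp [hj]
      rw [e, ← PiTensorProduct.tprod_mul_tprod]
      exact (h i (b i)).mul_right ih
  simpa using key Finset.univ

/-- The tensor power over `k[[ħ]]` of a deformation of `A` deforms `A^{⊗n}`. -/
theorem PreQuantization.exists_tensorPower {P : PoissonStructure k A} (D : PreQuantization P H)
    (n : ℕ) : ∃ E : PreQuantization (P.tensorPower n) (⨂[PowerSeries k] _ : Fin n, H),
      ∀ a : Fin n → H,
        E.proj (PiTensorProduct.tprod _ a) = PiTensorProduct.tprod k fun i => D.proj (a i) := by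
  obtain ⟨π, hπ, hπs⟩ := PiTensorProduct.exists_reduction (n := n) D.proj D.proj_smul
  have htf : Module.IsTorsionFree (PowerSeries k) H :=
    PowerSeries.isTorsionFree_of_X_smul D.eq_zero_of_X_smul
  have hflat : Module.Flat (PowerSeries k) (⨂[PowerSeries k] _ : Fin n, H) :=
    PiTensorProduct.flat_fin n
  have hX : ∀ x : ⨂[PowerSeries k] _ : Fin n, H, (PowerSeries.X : PowerSeries k) • x = 0
      → x = 0 := by
    intro x hx
    exact (smul_eq_zero.mp hx).resolve_left PowerSeries.X_ne_zero
  have hpair : ∀ x y, QuantizedPair (P.tensorPower n) π x y := by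
    have hsingle : ∀ (i : Fin n) (a : H),
        π (PiTensorProduct.tprod _ (Pi.mulSingle i a : Fin n → H))
          = PoissonStructure.single k i (D.proj a) := by
      intro i a
      rw [hπ, PoissonStructure.single, PiTensorProduct.singleAlgHom_apply]
      congr 1
      ext j
      by_cases hj : j = i
      · subst hj; simp
      · simp [hj]
    have h1 : ∀ (i j : Fin n) (a b : H), QuantizedPair (P.tensorPower n) π
        (PiTensorProduct.tprod (PowerSeries k) (Pi.mulSingle i a : Fin n → H))
        (PiTensorProduct.tprod (PowerSeries k) (Pi.mulSingle j b : Fin n → H)) := by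
      intro i j a b
      have hbr := P.tensorBracket_single i j (D.proj a) (D.proj b)
      by_cases hij : i = j
      · subst hij
        obtain ⟨z, hz, hz'⟩ := D.quantizedPair a b
        refine ⟨PiTensorProduct.tprod _ (Pi.mulSingle i z), ?_, ?_⟩
        · have := congrArg (PiTensorProduct.singleAlgHom (R := PowerSeries k)
            (A := fun _ : Fin n => H) i) hz
          rw [map_sub, map_mul, map_mul, map_smul] at this
          exact this
        · rw [hsingle, hsingle, hsingle, ← hz']
          rw [if_pos rfl] at hbr
          exact hbr
      · refine QuantizedPair.of_commute
          (Commute.tprod (Pi.mulSingle_commute (f := fun _ : Fin n => H) hij a b)) ?_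
        rw [hsingle, hsingle]
        rw [if_neg hij] at hbr
        exact hbr
    have hmul : ∀ x, (∀ b, QuantizedPair (P.tensorPower n) π x
        (PiTensorProduct.tprod (PowerSeries k) b)) →
        ∀ y, QuantizedPair (P.tensorPower n) π x y := by
      intro x h y
      induction y using PiTensorProduct.induction_on with
      | add y z hy hz => exact hy.add_right hz
      | smul_tprod c b => exact (h b).smul_right hπs c
    refine fun x => hmul x fun b => QuantizedPair.tprod_right x (fun i b => ?_) b
    refine (hmul _ (fun c => QuantizedPair.tprod_right _ (fun j c => ?_) c) x).symm
    exact h1 i j b c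
  refine ⟨⟨hX, π, hπs, ?_, ?_, fun x y z => (hpair x y).commutator hX z⟩, hπ⟩
  · intro y
    induction y using PiTensorProduct.induction_on with
    | add y z hy hz =>
      obtain ⟨a, rfl⟩ := hy
      obtain ⟨b, rfl⟩ := hz
      exact ⟨a + b, map_add _ _ _⟩
    | smul_tprod r b =>
      choose a ha using fun i => D.proj_surjective (b i)
      exact ⟨(PowerSeries.C r : PowerSeries k) • PiTensorProduct.tprod _ a, by
        rw [hπs, hπ]; simp [ha]⟩
  · intro x
    refine ⟨PiTensorProduct.exists_of_reduction_eq_zero D.proj D.proj_smul D.proj_surjective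
      (fun x => (D.proj_eq_zero_iff x).mp) π hπ hπs x, ?_⟩
    rintro ⟨y, rfl⟩
    simp [hπs]

end TensorReduction

/-! ### Localization of the truncations -/

section HbarIdeal

variable (k : Type*) (H : Type*) [Field k] [Ring H] [Algebra (PowerSeries k) H]

/-- The two-sided ideal `ħᵐ H`. -/
def hbarIdeal (m : ℕ) : Ideal H where
  carrier := {x | ∃ y, x = (PowerSeries.X : PowerSeries k) ^ m • y}
  add_mem' := by
    rintro _ _ ⟨a, rfl⟩ ⟨b, rfl⟩
    exact ⟨a + b, (smul_add _ _ _).symm⟩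
  zero_mem' := ⟨0, (smul_zero _).symm⟩
  smul_mem' := by
    rintro c _ ⟨a, rfl⟩
    exact ⟨c * a, by rw [smul_eq_mul, mul_smul_comm]⟩

variable {k H}

instance (m : ℕ) : (hbarIdeal k H m).IsTwoSided := ⟨by
  rintro _ b ⟨a, rfl⟩
  exact ⟨a * b, by rw [smul_mul_assoc]⟩⟩

end HbarIdeal

namespace PreQuantization

variable {k : Type*} {B : Type*} {H : Type*} [Field k] [CommRing B] [Algebra k B]
  [Ring H] [Algebra (PowerSeries k) H] {P : PoissonStructure k B}

/-- `s ^ m` moves every `a` to the other side of `s` modulo `ħᵐ`, since `ad s` is divisible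
by `ħ`. -/
theorem exists_pow_mul_eq (D : PreQuantization P H) (s a : H) (m : ℕ) :
    ∃ b y, s ^ m * a = b * s + (PowerSeries.X : PowerSeries k) ^ m • y := by
  induction m with
  | zero => exact ⟨0, a, by simp⟩
  | succ m ih =>
    obtain ⟨b, y, h⟩ := ih
    obtain ⟨z, hz, -⟩ := D.quantizedPair s y
    refine ⟨s * b + (PowerSeries.X : PowerSeries k) ^ m • y, z, ?_⟩
    rw [pow_succ' s, mul_assoc, h, pow_succ (PowerSeries.X : PowerSeries k), mul_smul, ← hz]
    rw [mul_add, mul_smul_comm, add_mul, smul_mul_assoc, smul_sub, mul_assoc]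
    abel

theorem X_smul_injective (D : PreQuantization P H) {x y : H}
    (h : (PowerSeries.X : PowerSeries k) • x = (PowerSeries.X : PowerSeries k) • y) : x = y :=
  sub_eq_zero.mp (D.eq_zero_of_X_smul _ (by rw [smul_sub, h, sub_self]))

variable [IsDomain B] (D : PreQuantization P H)

/-- The elements of `H` which are nonzero modulo `ħ`. -/
def denominators : Submonoid H where
  carrier := {s | D.proj s ≠ 0}
  one_mem' := by simp
  mul_mem' := by
    intro a b ha hb
    simpa using ⟨ha, hb⟩

/-- The denominators are regular modulo every power of `ħ`. -/
theorem mem_hbarIdeal_of_mul_mem_left {s : H} (hs : s ∈ D.denominators) (m : ℕ) (a : H)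
    (h : s * a ∈ hbarIdeal k H m) : a ∈ hbarIdeal k H m := by
  induction m generalizing a with
  | zero => exact ⟨a, by simp⟩
  | succ m ih =>
    obtain ⟨y, hy⟩ := h
    rw [pow_succ', mul_smul] at hy
    have h0 : D.proj s * D.proj a = 0 := by
      rw [← map_mul]
      exact (D.proj_eq_zero_iff _).mpr ⟨_, hy⟩
    obtain ⟨b, rfl⟩ := (D.proj_eq_zero_iff a).mp ((mul_eq_zero.mp h0).resolve_left hs)
    rw [mul_smul_comm] at hy
    obtain ⟨c, hc⟩ := ih b ⟨y, D.X_smul_injective hy⟩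
    exact ⟨c, by rw [hc, pow_succ', mul_smul]⟩

theorem mem_hbarIdeal_of_mul_mem_right {s : H} (hs : s ∈ D.denominators) (m : ℕ) (a : H)
    (h : a * s ∈ hbarIdeal k H m) : a ∈ hbarIdeal k H m := by
  induction m generalizing a with
  | zero => exact ⟨a, by simp⟩
  | succ m ih =>
    obtain ⟨y, hy⟩ := h
    rw [pow_succ', mul_smul] at hy
    have h0 : D.proj a * D.proj s = 0 := by
      rw [← map_mul]
      exact (D.proj_eq_zero_iff _).mpr ⟨_, hy⟩
    obtain ⟨b, rfl⟩ := (D.proj_eq_zero_iff a).mp ((mul_eq_zero.mp h0).resolve_right hs)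
    rw [smul_mul_assoc] at hy
    obtain ⟨c, hc⟩ := ih b ⟨y, D.X_smul_injective hy⟩
    exact ⟨c, by rw [hc, pow_succ', mul_smul]⟩

/-- The image of `denominators` in `H / ħᵐ H`. -/
def truncDenominators (m : ℕ) : Submonoid (H ⧸ hbarIdeal k H m) :=
  D.denominators.map (Ideal.Quotient.mk (hbarIdeal k H m))

theorem nonempty_oreSet (m : ℕ) : Nonempty (OreLocalization.OreSet (D.truncDenominators m)) := by
  rw [OreLocalization.nonempty_oreSet_iff]
  constructor
  · rintro r₁ r₂ ⟨_, s, hs, rfl⟩ h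
    obtain ⟨a, rfl⟩ := Ideal.Quotient.mk_surjective r₁
    obtain ⟨b, rfl⟩ := Ideal.Quotient.mk_surjective r₂
    refine ⟨1, ?_⟩
    simp only [← map_mul] at h
    rw [Ideal.Quotient.eq, ← sub_mul] at h
    rw [Ideal.Quotient.eq.mpr (D.mem_hbarIdeal_of_mul_mem_right hs m _ h)]
  · rintro r ⟨_, s, hs, rfl⟩
    obtain ⟨a, rfl⟩ := Ideal.Quotient.mk_surjective r
    obtain ⟨b, y, h⟩ := D.exists_pow_mul_eq s a m
    refine ⟨Ideal.Quotient.mk _ b, ⟨_, s ^ m, pow_mem hs m, rfl⟩, ?_⟩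
    simp only [← map_mul]
    rw [Ideal.Quotient.eq, h, add_sub_cancel_left]
    exact ⟨y, rfl⟩

noncomputable instance (m : ℕ) : OreLocalization.OreSet (D.truncDenominators m) :=
  (D.nonempty_oreSet m).some

/-- The localization of `H / ħᵐ H` at the elements which are nonzero modulo `ħ`. -/
abbrev TruncLocalization (m : ℕ) : Type _ :=
  OreLocalization (D.truncDenominators m) (H ⧸ hbarIdeal k H m)

/-- The canonical map from `H` to the localization of `H / ħᵐ H`. -/
noncomputable def toTrunc (m : ℕ) : H →ₐ[PowerSeries k] D.TruncLocalization m :=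
  { (OreLocalization.numeratorRingHom (S := D.truncDenominators m)).comp
      (Ideal.Quotient.mk (hbarIdeal k H m)) with
    commutes' := fun _ => rfl }

theorem toTrunc_apply (m : ℕ) (a : H) : D.toTrunc m a
    = OreLocalization.numeratorHom (S := D.truncDenominators m)
      (Ideal.Quotient.mk (hbarIdeal k H m) a) := rfl

theorem toTrunc_eq_zero_iff (m : ℕ) (a : H) : D.toTrunc m a = 0 ↔ a ∈ hbarIdeal k H m := by
  have hinj : Function.Injective (OreLocalization.numeratorHom (S := D.truncDenominators m)) := by
    apply OreLocalization.numeratorHom_inj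
    rintro _ ⟨s, hs, rfl⟩ r h
    obtain ⟨a, rfl⟩ := Ideal.Quotient.mk_surjective r
    rw [← map_mul, Ideal.Quotient.eq_zero_iff_mem] at h
    exact Ideal.Quotient.eq_zero_iff_mem.mpr (D.mem_hbarIdeal_of_mul_mem_left hs m a h)
  rw [← Ideal.Quotient.eq_zero_iff_mem, toTrunc_apply]
  constructor
  · intro h
    apply hinj
    rw [h]
    exact (map_zero (OreLocalization.numeratorRingHom (S := D.truncDenominators m))).symm
  · intro h
    rw [h]
    exact map_zero (OreLocalization.numeratorRingHom (S := D.truncDenominators m))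

theorem isUnit_toTrunc (m : ℕ) {s : H} (hs : s ∈ D.denominators) : IsUnit (D.toTrunc m s) :=
  OreLocalization.numerator_isUnit (S := D.truncDenominators m) ⟨_, s, hs, rfl⟩

theorem exists_toTrunc_mul_eq (m : ℕ) (x : D.TruncLocalization m) :
    ∃ s ∈ D.denominators, ∃ a, D.toTrunc m s * x = D.toTrunc m a := by
  induction x using OreLocalization.ind with | _ r s
  obtain ⟨_, s, hs, rfl⟩ := s
  obtain ⟨a, rfl⟩ := Ideal.Quotient.mk_surjective r
  refine ⟨s, hs, a, ?_⟩
  rw [toTrunc_apply, toTrunc_apply, OreLocalization.numeratorHom_apply,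
    OreLocalization.numeratorHom_apply]
  exact OreLocalization.mul_cancel (s := (⟨_, s, hs, rfl⟩ : D.truncDenominators m)) (t := 1)

/-- The universal property of the localization of `H / ħᵐ H`. -/
theorem exists_truncLift {C : Type*} [Ring C] (m : ℕ) (f : H →+* C)
    (hf : ∀ a ∈ hbarIdeal k H m, f a = 0) (hu : ∀ s ∈ D.denominators, IsUnit (f s)) :
    ∃ g : D.TruncLocalization m →+* C, ∀ a, g (D.toTrunc m a) = f a := by
  let f' : (H ⧸ hbarIdeal k H m) →+* C := Ideal.Quotient.lift _ f hf
  have hu' : ∀ s, IsUnit ((f'.toMonoidHom.comp (D.truncDenominators m).subtype) s) := by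
    rintro ⟨_, s, hs, rfl⟩
    exact hu s hs
  let fS : D.truncDenominators m →* Cˣ :=
    IsUnit.liftRight (f'.toMonoidHom.comp (D.truncDenominators m).subtype) hu'
  refine ⟨OreLocalization.universalHom f' fS fun s =>
    (IsUnit.coe_liftRight (f'.toMonoidHom.comp (D.truncDenominators m).subtype) hu' s).symm,
    fun a => ?_⟩
  exact OreLocalization.universalHom_commutes f' fS _

/-! ### The complete localization -/

theorem X_pow_smul_trunc (m : ℕ) (x : D.TruncLocalization m) :
    (PowerSeries.X : PowerSeries k) ^ m • x = 0 := by
  obtain ⟨s, hs, a, h⟩ := D.exists_toTrunc_mul_eq m x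
  rw [← (D.isUnit_toTrunc m hs).mul_right_eq_zero, mul_smul_comm, h, ← map_smul]
  exact (D.toTrunc_eq_zero_iff m _).mpr ⟨a, rfl⟩

theorem exists_transition (m : ℕ) :
    ∃ t : D.TruncLocalization (m + 1) →ₐ[PowerSeries k] D.TruncLocalization m,
      ∀ a, t (D.toTrunc (m + 1) a) = D.toTrunc m a := by
  obtain ⟨t, ht⟩ := D.exists_truncLift (m + 1) (D.toTrunc m).toRingHom
    (by
      rintro _ ⟨y, rfl⟩
      exact (D.toTrunc_eq_zero_iff m _).mpr
        ⟨(PowerSeries.X : PowerSeries k) • y, by rw [pow_succ, mul_smul]⟩)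
    (fun s hs => D.isUnit_toTrunc m hs)
  refine ⟨{ t with commutes' := fun r => ?_ }, ht⟩
  have h := ht (algebraMap _ _ r)
  rw [AlgHom.commutes] at h
  exact h.trans (AlgHom.commutes _ r)

/-- The transition map between the localizations of `H / ħᵐ⁺¹ H` and `H / ħᵐ H`. -/
noncomputable def transition (m : ℕ) :
    D.TruncLocalization (m + 1) →ₐ[PowerSeries k] D.TruncLocalization m :=
  (D.exists_transition m).choose

@[simp] theorem transition_toTrunc (m : ℕ) (a : H) :
    D.transition m (D.toTrunc (m + 1) a) = D.toTrunc m a :=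
  (D.exists_transition m).choose_spec a

/-- The `ħ`-torsion at level `m + 1` consists of multiples of `ħᵐ`, which vanish at level `m`. -/
theorem transition_eq_zero_of_X_smul (m : ℕ) (x : D.TruncLocalization (m + 1))
    (hx : (PowerSeries.X : PowerSeries k) • x = 0) : D.transition m x = 0 := by
  obtain ⟨s, hs, a, h⟩ := D.exists_toTrunc_mul_eq (m + 1) x
  have h1 : D.toTrunc (m + 1) ((PowerSeries.X : PowerSeries k) • a) = 0 := by
    rw [map_smul, ← h, ← mul_smul_comm, hx, mul_zero]
  obtain ⟨y, hy⟩ := (D.toTrunc_eq_zero_iff _ _).mp h1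
  rw [pow_succ', mul_smul] at hy
  have h2 : D.toTrunc m a = 0 := (D.toTrunc_eq_zero_iff _ _).mpr ⟨y, D.X_smul_injective hy⟩
  have h3 := congrArg (D.transition m) h
  rw [map_mul, transition_toTrunc, transition_toTrunc, h2] at h3
  exact (D.isUnit_toTrunc m hs).mul_right_eq_zero.mp h3

theorem exists_truncProj (m : ℕ) : ∃ p : D.TruncLocalization (m + 1) →+* FractionRing B,
    ∀ a, p (D.toTrunc (m + 1) a) = algebraMap B (FractionRing B) (D.proj a) := by
  refine D.exists_truncLift (m + 1) ((algebraMap B (FractionRing B)).comp D.proj) ?_ ?_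
  · rintro _ ⟨y, rfl⟩
    rw [RingHom.comp_apply, (D.proj_eq_zero_iff _).mpr
      ⟨(PowerSeries.X : PowerSeries k) ^ m • y, by rw [pow_succ', mul_smul]⟩, map_zero]
  · intro s hs
    exact (IsFractionRing.to_map_ne_zero_of_mem_nonZeroDivisors
      (mem_nonZeroDivisors_of_ne_zero hs)).isUnit

/-- Reduction modulo `ħ` on the localization of `H / ħᵐ⁺¹ H`. -/
noncomputable def truncProj (m : ℕ) : D.TruncLocalization (m + 1) →+* FractionRing B :=
  (D.exists_truncProj m).choose

@[simp] theorem truncProj_toTrunc (m : ℕ) (a : H) :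
    D.truncProj m (D.toTrunc (m + 1) a) = algebraMap B (FractionRing B) (D.proj a) :=
  (D.exists_truncProj m).choose_spec a

theorem algebraMap_proj_ne_zero {s : H} (hs : s ∈ D.denominators) :
    algebraMap B (FractionRing B) (D.proj s) ≠ 0 :=
  IsFractionRing.to_map_ne_zero_of_mem_nonZeroDivisors (mem_nonZeroDivisors_of_ne_zero hs)

theorem truncProj_transition (m : ℕ) (x : D.TruncLocalization (m + 1 + 1)) :
    D.truncProj m (D.transition (m + 1) x) = D.truncProj (m + 1) x := by
  obtain ⟨s, hs, a, h⟩ := D.exists_toTrunc_mul_eq _ x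
  apply mul_left_cancel₀ (D.algebraMap_proj_ne_zero hs)
  have h1 := congrArg (D.truncProj (m + 1)) h
  have h2 := congrArg (fun y => D.truncProj m (D.transition (m + 1) y)) h
  simp only [map_mul, transition_toTrunc, truncProj_toTrunc] at h1 h2
  rw [h1, h2]

theorem exists_eq_X_smul_of_truncProj_eq_zero (m : ℕ) (x : D.TruncLocalization (m + 1))
    (hx : D.truncProj m x = 0) : ∃ y, x = (PowerSeries.X : PowerSeries k) • y := by
  obtain ⟨s, hs, a, h⟩ := D.exists_toTrunc_mul_eq _ x
  have h1 := congrArg (D.truncProj m) h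
  rw [map_mul, hx, mul_zero, truncProj_toTrunc] at h1
  obtain ⟨b, rfl⟩ := (D.proj_eq_zero_iff a).mp
    ((IsFractionRing.to_map_eq_zero_iff (K := FractionRing B)).mp h1.symm)
  obtain ⟨u, hu⟩ := D.isUnit_toTrunc (m + 1) hs
  refine ⟨↑u⁻¹ * D.toTrunc (m + 1) b, ?_⟩
  rw [← mul_smul_comm, ← map_smul, ← h, ← hu, Units.inv_mul_cancel_left]

/-- The `ħ`-adically complete localization of `H` at the elements which are nonzero modulo `ħ`: the
limit over `m` of the Ore localizations of `H / ħᵐ H`. -/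
noncomputable def completeLocalization :
    Subalgebra (PowerSeries k) (∀ m, D.TruncLocalization m) where
  carrier := {x | ∀ m, D.transition m (x (m + 1)) = x m}
  mul_mem' := fun ha hb m => by simp only [Pi.mul_apply, map_mul, ha m, hb m]
  add_mem' := fun ha hb m => by simp only [Pi.add_apply, map_add, ha m, hb m]
  algebraMap_mem' := fun r m => by simp only [Pi.algebraMap_apply, AlgHom.commutes]

variable {D} in
theorem transition_coe (x : D.completeLocalization) (m : ℕ) :
    D.transition m (x.1 (m + 1)) = x.1 m := x.2 m

/-- The canonical map from `H` to its complete localization. -/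
noncomputable def toCompleteLocalization : H →ₐ[PowerSeries k] D.completeLocalization :=
  (AlgHom.pi D.toTrunc).codRestrict D.completeLocalization
    fun a m => D.transition_toTrunc m a

/-- Reduction modulo `ħ` on the complete localization. -/
noncomputable def completeProj : D.completeLocalization →+* FractionRing B :=
  ((D.truncProj 0).comp (Pi.evalRingHom _ 1)).comp D.completeLocalization.val.toRingHom

@[simp] theorem completeProj_toCompleteLocalization (a : H) :
    D.completeProj (D.toCompleteLocalization a) = algebraMap B (FractionRing B) (D.proj a) :=
  D.truncProj_toTrunc 0 a

theorem truncProj_coe (x : D.completeLocalization) (m : ℕ) :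
    D.truncProj m (x.1 (m + 1)) = D.completeProj x := by
  induction m with
  | zero => rfl
  | succ m ih => rw [← ih, ← truncProj_transition, transition_coe]

theorem completeProj_smul (c : PowerSeries k) (x : D.completeLocalization) :
    D.completeProj (c • x) = PowerSeries.constantCoeff c • D.completeProj x := by
  rw [Algebra.smul_def, map_mul, ← AlgHom.commutes D.toCompleteLocalization,
    completeProj_toCompleteLocalization, Algebra.algebraMap_eq_smul_one (A := H), D.proj_smul,
    map_one, ← Algebra.algebraMap_eq_smul_one (A := B), ← IsScalarTower.algebraMap_apply,
    ← Algebra.smul_def]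

theorem eq_X_smul_of_completeProj_eq_zero (x : D.completeLocalization)
    (hx : D.completeProj x = 0) :
    ∃ y : D.completeLocalization, x = (PowerSeries.X : PowerSeries k) • y := by
  have h : ∀ m, ∃ z, x.1 (m + 1) = (PowerSeries.X : PowerSeries k) • z := fun m =>
    D.exists_eq_X_smul_of_truncProj_eq_zero m _ (by rw [truncProj_coe, hx])
  choose z hz using h
  -- `z m` is only defined up to `ħ`-torsion, which the transition map kills.
  refine ⟨⟨fun m => D.transition m (z m), fun m => ?_⟩, ?_⟩
  · rw [← sub_eq_zero, ← map_sub]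
    apply D.transition_eq_zero_of_X_smul
    rw [smul_sub, ← hz, ← map_smul, ← hz, transition_coe, sub_self]
  · ext m
    change x.1 m = (PowerSeries.X : PowerSeries k) • D.transition m (z m)
    rw [← map_smul, ← hz, transition_coe]

theorem eq_X_pow_smul_of_apply_eq_zero (m : ℕ) (x : D.completeLocalization) (hx : x.1 m = 0) :
    ∃ y : D.completeLocalization, x = (PowerSeries.X : PowerSeries k) ^ m • y := by
  induction m generalizing x with
  | zero => exact ⟨x, by simp⟩
  | succ m ih =>
    obtain ⟨y, rfl⟩ := D.eq_X_smul_of_completeProj_eq_zero x (by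
      rw [← D.truncProj_coe x m, hx, map_zero])
    obtain ⟨z, rfl⟩ := ih y (by
      rw [← transition_coe]
      exact D.transition_eq_zero_of_X_smul m _ hx)
    exact ⟨z, by rw [pow_succ', mul_smul]⟩

theorem hbarComplete_completeLocalization : HbarComplete k D.completeLocalization where
  eq_zero_of_X_smul := by
    intro x hx
    ext m
    rw [← transition_coe]
    exact D.transition_eq_zero_of_X_smul m _ (congrFun (congrArg Subtype.val hx) (m + 1))
  separated := by
    intro x hx
    ext m
    obtain ⟨y, rfl⟩ := hx m
    exact D.X_pow_smul_trunc m (y.1 m)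
  complete := by
    intro a
    let S : ℕ → D.completeLocalization := fun m =>
      ∑ i ∈ Finset.range m, (PowerSeries.X : PowerSeries k) ^ i • a i
    have hS : ∀ m, (S (m + 1)).1 m = (S m).1 m := by
      intro m
      have h : S (m + 1) = S m + (PowerSeries.X : PowerSeries k) ^ m • a m :=
        Finset.sum_range_succ _ _
      rw [h]
      change (S m).1 m + (PowerSeries.X : PowerSeries k) ^ m • (a m).1 m = _
      rw [X_pow_smul_trunc, add_zero]
    let x : D.completeLocalization := ⟨fun m => (S m).1 m, fun m => by
      rw [transition_coe, hS]⟩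
    refine ⟨x, fun m => ?_⟩
    obtain ⟨y, hy⟩ := D.eq_X_pow_smul_of_apply_eq_zero m (x - S m)
      (sub_self ((S m).1 m))
    exact ⟨y, by rw [← hy]; exact (add_sub_cancel _ _).symm⟩

theorem exists_inverse {s : H} (hs : s ∈ D.denominators) : ∃ u : D.completeLocalization,
    D.toCompleteLocalization s * u = 1 ∧ u * D.toCompleteLocalization s = 1 := by
  choose v hv using fun m => D.isUnit_toTrunc m hs
  have hmem : (fun m => (↑(v m)⁻¹ : D.TruncLocalization m)) ∈ D.completeLocalization := by
    intro m
    apply (D.isUnit_toTrunc m hs).mul_left_cancel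
    conv_lhs => rw [← transition_toTrunc, ← map_mul, ← hv, Units.mul_inv, map_one]
    rw [← hv, Units.mul_inv]
  refine ⟨⟨_, hmem⟩, ?_, ?_⟩
  · ext m
    change D.toTrunc m s * ↑(v m)⁻¹ = 1
    rw [← hv, Units.mul_inv]
  · ext m
    change ↑(v m)⁻¹ * D.toTrunc m s = 1
    rw [← hv, Units.inv_mul]

/-- Every element of `Frac B` lifts to a left fraction of elements of `H`. -/
theorem exists_fraction (x : FractionRing B) : ∃ (s a : H) (u : D.completeLocalization),
    D.toCompleteLocalization s * u = 1 ∧ u * D.toCompleteLocalization s = 1 ∧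
    D.completeProj (u * D.toCompleteLocalization a) = x := by
  obtain ⟨⟨b, t⟩, hbt⟩ := IsLocalization.surj (nonZeroDivisors B) x
  obtain ⟨a, ha⟩ := D.proj_surjective b
  obtain ⟨s, hs⟩ := D.proj_surjective t
  have hsd : s ∈ D.denominators := by
    change D.proj s ≠ 0
    rw [hs]
    exact nonZeroDivisors.ne_zero t.2
  obtain ⟨u, hu, hu'⟩ := D.exists_inverse hsd
  refine ⟨s, a, u, hu, hu', ?_⟩
  apply mul_left_cancel₀ (D.algebraMap_proj_ne_zero hsd)
  rw [← completeProj_toCompleteLocalization, ← map_mul, ← mul_assoc, hu, one_mul,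
    completeProj_toCompleteLocalization, completeProj_toCompleteLocalization, ha, hs, mul_comm]
  exact hbt.symm

theorem quantizedPair_completeLocalization (x y : D.completeLocalization) :
    QuantizedPair P.fraction D.completeProj x y := by
  have h1 : ∀ a b, QuantizedPair P.fraction D.completeProj (D.toCompleteLocalization a)
      (D.toCompleteLocalization b) := by
    intro a b
    obtain ⟨z, hz, hz'⟩ := D.quantizedPair a b
    refine ⟨D.toCompleteLocalization z, ?_, ?_⟩
    · rw [← map_mul, ← map_mul, ← map_sub, hz, map_smul]
    · simp only [completeProj_toCompleteLocalization]
      rw [P.fraction_algebraMap, hz']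
  -- Modulo `ħ`, every element of the localization is a fraction of elements of `H`.
  have h2 : ∀ x, (∀ a, QuantizedPair P.fraction D.completeProj x (D.toCompleteLocalization a)) →
      ∀ y, QuantizedPair P.fraction D.completeProj x y := by
    intro x hx y
    obtain ⟨s, a, u, hu, hu', hua⟩ := D.exists_fraction (D.completeProj y)
    obtain ⟨z, hz⟩ := D.eq_X_smul_of_completeProj_eq_zero (y - u * D.toCompleteLocalization a)
      (by rw [map_sub, hua, sub_self])
    rw [sub_eq_iff_eq_add'.mp hz]
    exact (((hx s).inv_right hu hu').mul_right (hx a)).add_right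
      (QuantizedPair.X_smul_right D.completeProj_smul x z)
  exact h2 x (fun a => (h2 _ (h1 a) x).symm) y

/-- The complete localization quantizes the Poisson structure of the fraction field. -/
noncomputable def completeLocalizationQuantization :
    Quantization P.fraction D.completeLocalization where
  topologicallyFree := D.hbarComplete_completeLocalization.isTopologicallyFree
  proj := D.completeProj
  proj_smul := D.completeProj_smul
  proj_surjective := fun x => by
    obtain ⟨s, a, u, -, -, h⟩ := D.exists_fraction x
    exact ⟨_, h⟩
  proj_eq_zero_iff := fun x => by
    refine ⟨D.eq_X_smul_of_completeProj_eq_zero x, ?_⟩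
    rintro ⟨y, rfl⟩
    simp [completeProj_smul]
  commutator := fun x y z h => (D.quantizedPair_completeLocalization x y).commutator
    D.hbarComplete_completeLocalization.eq_zero_of_X_smul z h

end PreQuantization

/-! ### Linear systems with commuting rows -/

section LinearSystem

variable {k : Type*} {K : Type*} {L : Type*} [Field k] [Field K] [Algebra k K]
  [Ring L] [Algebra (PowerSeries k) L] {P : PoissonStructure k K} {n : ℕ}

open Matrix

/-- A linear system over an `ħ`-complete quantization is solvable if its reduction modulo `ħ` is
invertible: the solution is found order by order in `ħ`. -/
theorem Quantization.exists_mulVec_eq (Q : Quantization P L) (hL : HbarComplete k L)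
    (M : Matrix (Fin n) (Fin n) L) (hM : (M.map Q.proj).det ≠ 0) (V : Fin n → L) :
    ∃ x : Fin n → L, M *ᵥ x = V := by
  have hstep : ∀ w : Fin n → L, ∃ u r : Fin n → L,
      w = M *ᵥ u + (PowerSeries.X : PowerSeries k) • r := by
    intro w
    choose u hu using fun j => Q.proj_surjective (((M.map Q.proj)⁻¹ *ᵥ fun i => Q.proj (w i)) j)
    have h : ∀ i, ∃ r, (w - M *ᵥ u) i = (PowerSeries.X : PowerSeries k) • r := by
      intro i
      rw [← Q.proj_eq_zero_iff, Pi.sub_apply, map_sub, RingHom.map_mulVec]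
      have : Q.proj ∘ u = (M.map Q.proj)⁻¹ *ᵥ fun i => Q.proj (w i) := funext hu
      rw [this, mulVec_mulVec, mul_nonsing_inv _ (Ne.isUnit hM), one_mulVec, sub_self]
    choose r hr using h
    refine ⟨u, r, ?_⟩
    rw [← sub_eq_iff_eq_add']
    exact funext hr
  -- The error `r w` left after each step is the right-hand side of the next one.
  choose u r hur using hstep
  let w : ℕ → Fin n → L := fun m => r^[m] V
  have hw : ∀ m, w (m + 1) = r (w m) := fun m => Function.iterate_succ_apply' r m V
  choose x hx using fun j => hL.complete fun m => u (w m) j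
  refine ⟨x, funext fun i => (sub_eq_zero.mp (hL.separated _ fun m => ?_)).symm⟩
  have hV : ∀ m, V = M *ᵥ (∑ i ∈ Finset.range m, (PowerSeries.X : PowerSeries k) ^ i • u (w i))
      + (PowerSeries.X : PowerSeries k) ^ m • w m := by
    intro m
    induction m with
    | zero => simp [w]
    | succ m ih =>
      rw [Finset.sum_range_succ, mulVec_add, mulVec_smul, add_assoc, hw, pow_succ, mul_smul,
        ← smul_add, ← hur, ← ih]
  choose y hy using fun j => hx j m
  have hx' : x = ∑ i ∈ Finset.range m, (PowerSeries.X : PowerSeries k) ^ i • u (w i)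
      + (PowerSeries.X : PowerSeries k) ^ m • y := by
    ext j
    rw [hy j]
    simp
  refine ⟨(w m - M *ᵥ y) i, ?_⟩
  have h := congrFun (hV m) i
  rw [hx', mulVec_add, mulVec_smul, h]
  simp [smul_sub]

/-- The quadratic form of an alternating matrix vanishes. -/
theorem Matrix.sum_mul_mul_eq_zero_of_alternating {ι R : Type*} [Fintype ι] [CommRing R]
    (c : ι → ι → R) (h0 : ∀ j, c j j = 0) (h1 : ∀ j l, c j l = -c l j) (a : ι → R) :
    ∑ j, ∑ l, a j * a l * c j l = 0 := by
  classical
  rw [← Fintype.sum_prod_type' (f := fun j l => a j * a l * c j l)]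
  refine Finset.sum_involution (fun p _ => p.swap) ?_ ?_ (fun _ _ => Finset.mem_univ _)
    (fun p _ => Prod.swap_swap p)
  · rintro ⟨j, l⟩ -
    simp only [Prod.swap]
    rw [h1 l j]
    ring
  · rintro ⟨j, l⟩ - h h'
    have : l = j := congrArg Prod.fst h'
    subst this
    exact h (by simp [h0])

/-- An alternating family `c` over a quantization with `∑ Mᵢⱼ Mₖₗ cⱼₗ = 0` for `i ≠ k` vanishes
modulo `ħ`, because its reduction satisfies `M c Mᵀ = 0`. -/
theorem Quantization.proj_eq_zero_of_alternating (Q : Quantization P L)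
    (M : Matrix (Fin n) (Fin n) L) (hM : (M.map Q.proj).det ≠ 0) (c : Fin n → Fin n → L)
    (h0 : ∀ j, c j j = 0) (h1 : ∀ j l, c j l = -c l j)
    (h2 : ∀ i i', i ≠ i' → ∑ j, ∑ l, M i j * M i' l * c j l = 0) (j l : Fin n) :
    Q.proj (c j l) = 0 := by
  let C : Matrix (Fin n) (Fin n) K := Matrix.of fun j l => Q.proj (c j l)
  have hC : M.map Q.proj * C * (M.map Q.proj)ᵀ = 0 := by
    ext i i'
    have e : (M.map Q.proj * C * (M.map Q.proj)ᵀ) i i'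
        = ∑ j, ∑ l, Q.proj (M i j) * Q.proj (M i' l) * Q.proj (c j l) := by
      simp only [mul_apply, transpose_apply, map_apply, C, of_apply, Finset.sum_mul]
      rw [Finset.sum_comm]
      refine Finset.sum_congr rfl fun j _ => Finset.sum_congr rfl fun l _ => ?_
      ring
    rw [e, Matrix.zero_apply]
    by_cases hi : i = i'
    · subst hi
      exact sum_mul_mul_eq_zero_of_alternating (fun j l => Q.proj (c j l))
        (fun j => by rw [h0, map_zero]) (fun j l => by rw [h1, map_neg]) _
    · have := congrArg Q.proj (h2 i i' hi)
      simpa only [map_sum, map_mul, map_zero] using this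
  have hu : IsUnit (M.map Q.proj) := (isUnit_iff_isUnit_det _).mpr (Ne.isUnit hM)
  have hut : IsUnit (M.map Q.proj)ᵀ :=
    (isUnit_iff_isUnit_det _).mpr (by rw [det_transpose]; exact Ne.isUnit hM)
  rw [hut.mul_left_eq_zero, hu.mul_right_eq_zero] at hC
  exact congrFun (congrFun hC j) l

/-- An alternating family `c` over a complete quantization with `∑ Mᵢⱼ Mₖₗ cⱼₗ = 0` for `i ≠ k` is
zero: it is divisible by `ħ`, and the quotient satisfies the same conditions. -/
theorem Quantization.eq_zero_of_alternating (Q : Quantization P L) (hL : HbarComplete k L)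
    (M : Matrix (Fin n) (Fin n) L) (hM : (M.map Q.proj).det ≠ 0) (c : Fin n → Fin n → L)
    (h0 : ∀ j, c j j = 0) (h1 : ∀ j l, c j l = -c l j)
    (h2 : ∀ i i', i ≠ i' → ∑ j, ∑ l, M i j * M i' l * c j l = 0) (j l : Fin n) :
    c j l = 0 := by
  refine hL.separated _ fun m => ?_
  induction m generalizing c with
  | zero => exact ⟨c j l, by simp⟩
  | succ m ih =>
    choose d hd using fun j l => (Q.proj_eq_zero_iff _).mp
      (Q.proj_eq_zero_of_alternating M hM c h0 h1 h2 j l)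
    obtain ⟨y, hy⟩ := ih d (fun j => hL.eq_zero_of_X_smul _ (by rw [← hd, h0]))
      (fun j l => by
        rw [← add_eq_zero_iff_eq_neg]
        refine hL.eq_zero_of_X_smul _ ?_
        rw [smul_add, ← hd, ← hd, h1 j l, neg_add_cancel])
      (fun i i' hi => by
        refine hL.eq_zero_of_X_smul _ ?_
        simp only [Finset.smul_sum, ← mul_smul_comm, ← hd]
        exact h2 i i' hi)
    exact ⟨y, by rw [hd, hy, pow_succ', mul_smul]⟩

/-- If the entries of the linear system `M x = V` commute whenever they lie in different rows, and
the reduction of `M` modulo `ħ` is invertible, then the entries of `x` commute. -/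
theorem Quantization.commute_of_mulVec_eq (Q : Quantization P L) (hL : HbarComplete k L)
    (M : Matrix (Fin n) (Fin n) L) (hM : (M.map Q.proj).det ≠ 0) (V x : Fin n → L)
    (hx : M *ᵥ x = V) (hMM : ∀ i i', i ≠ i' → ∀ j l, Commute (M i j) (M i' l))
    (hMV : ∀ i i', i ≠ i' → ∀ j, Commute (M i j) (V i'))
    (hVV : ∀ i i', i ≠ i' → Commute (V i) (V i')) (j l : Fin n) : Commute (x j) (x l) := by
  have hx' : ∀ i, ∑ j, M i j * x j = V i := fun i => congrFun hx i
  have h : ∀ i i', i ≠ i' → ∑ j, ∑ l, M i j * M i' l * (x j * x l) = V i * V i' := by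
    intro i i' hi
    rw [Finset.sum_comm]
    calc ∑ l, ∑ j, M i j * M i' l * (x j * x l) = ∑ l, M i' l * (∑ j, M i j * x j) * x l := by
          refine Finset.sum_congr rfl fun l _ => ?_
          rw [Finset.mul_sum, Finset.sum_mul]
          refine Finset.sum_congr rfl fun j _ => ?_
          rw [(hMM i i' hi j l).eq]
          simp only [mul_assoc]
      _ = ∑ l, V i * (M i' l * x l) := by
          refine Finset.sum_congr rfl fun l _ => ?_
          rw [hx', (hMV i' i hi.symm l).eq, mul_assoc]
      _ = V i * V i' := by rw [← Finset.mul_sum, hx']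
  refine sub_eq_zero.mp (Q.eq_zero_of_alternating hL M hM (fun j l => x j * x l - x l * x j)
    (fun j => sub_self _) (fun j l => (neg_sub _ _).symm) (fun i i' hi => ?_) j l)
  have h' : ∑ j, ∑ l, M i j * M i' l * (x l * x j) = V i' * V i := by
    rw [← h i' i hi.symm, Finset.sum_comm]
    refine Finset.sum_congr rfl fun j _ => Finset.sum_congr rfl fun l _ => ?_
    rw [(hMM i i' hi l j).eq]
  simp only [mul_sub, Finset.sum_sub_distrib]
  rw [h i i' hi, h', (hVV i i' hi).eq, sub_self]

end LinearSystem

/-! ### The classical family -/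

section Classical

variable {k : Type*} {A : Type*} [Field k] [CommRing A] [Algebra k A] {n : ℕ}

open Matrix PoissonStructure

theorem antisymTensor_eq_det (g : Fin n → A) :
    antisymTensor k g = (Matrix.of fun l j => single k j (g l)).det := by
  rw [antisymTensor, det_apply]
  refine Finset.sum_congr rfl fun σ _ => ?_
  rw [tprod_eq_prod_single]
  rfl

/-- Applying the functionals dual to `g` to the tensor factors gives the determinant of the identity
matrix. -/
theorem antisymTensor_ne_zero {g : Fin n → A} (hg : LinearIndependent k g) :
    antisymTensor k g ≠ 0 := by
  obtain ⟨φ, hφ⟩ := LinearMap.exists_leftInverse_of_injective (Finsupp.linearCombination k g)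
    (LinearMap.ker_eq_bot.mpr hg)
  have hφg : ∀ l, φ (g l) = Finsupp.single l 1 := by
    intro l
    have := LinearMap.congr_fun hφ (Finsupp.single l 1)
    simpa using this
  let Ψ : (⨂[k] _ : Fin n, A) →ₗ[k] k := PiTensorProduct.lift
    ((MultilinearMap.mkPiAlgebra k (Fin n) k).compLinearMap
      fun j => (Finsupp.lapply j).comp φ)
  have hΨ : ∀ a : Fin n → A, Ψ (PiTensorProduct.tprod k a) = ∏ j, φ (a j) j := by
    intro a
    simp [Ψ]
  have h1 : Ψ (antisymTensor k g) = (1 : Matrix (Fin n) (Fin n) k).det := by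
    rw [antisymTensor, det_apply, map_sum]
    refine Finset.sum_congr rfl fun σ _ => ?_
    rw [map_zsmul, hΨ, Units.smul_def]
    congr 1
    refine Finset.prod_congr rfl fun j _ => ?_
    rw [hφg, Finsupp.single_apply, one_apply]
  intro h
  rw [h, map_zero, det_one] at h1
  exact zero_ne_one h1

/-- Laplace expansion of a determinant with two equal columns. -/
theorem sum_single_mul_classicalDelta (f : Fin (n + 1) → A) (j : Fin n) :
    ∑ i : Fin (n + 1), (-1) ^ (i : ℕ) * single k j (f i) * classicalDelta k f i = 0 := by
  -- Column `j` is put in front of the `n` columns; it occurs again in position `j + 1`.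
  let N : Matrix (Fin (n + 1)) (Fin (n + 1)) (⨂[k] _ : Fin n, A) :=
    Matrix.of fun i l => single k ((Fin.cons j id : Fin (n + 1) → Fin n) l) (f i)
  have h : N.det = 0 := det_zero_of_column_eq (Fin.succ_ne_zero j).symm fun i => by simp [N]
  rw [det_succ_column_zero] at h
  rw [← h]
  refine Finset.sum_congr rfl fun i _ => ?_
  rw [classicalDelta, antisymTensor_eq_det]
  rfl

end Classical

/-! ### Quantization of the family -/

/-- The torsion-free deformation underlying a quantization, with its universe level raised so
that the construction of the quantized fraction field ends in the required universe. -/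
def Quantization.toPreQuantization {k : Type u} {B : Type v} {H : Type w} [Field k] [CommRing B]
    [Algebra k B] [Ring H] [Algebra (PowerSeries k) H] {P : PoissonStructure k B}
    (Q : Quantization P H) : PreQuantization P (ULift.{max u v} H) where
  eq_zero_of_X_smul := fun x hx => ULift.down_injective
    (Q.topologicallyFree.eq_zero_of_X_smul x.down (congrArg ULift.down hx))
  proj := Q.proj.comp (ULift.ringEquiv : ULift.{max u v} H ≃+* H).toRingHom
  proj_smul := fun c x => Q.proj_smul c x.down
  proj_surjective := fun b => by
    obtain ⟨a, ha⟩ := Q.proj_surjective b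
    exact ⟨ULift.up a, ha⟩
  proj_eq_zero_iff := fun x => by
    refine (Q.proj_eq_zero_iff x.down).trans ⟨?_, ?_⟩
    · rintro ⟨y, hy⟩
      exact ⟨ULift.up y, ULift.down_injective hy⟩
    · rintro ⟨y, hy⟩
      exact ⟨y.down, congrArg ULift.down hy⟩
  commutator := fun x y z h => Q.commutator x.down y.down z.down (congrArg ULift.down h)

open Matrix PoissonStructure in
/-- The signed solution of the lifted linear system quantizes the classical family. -/
theorem exists_familyQuantization {k : Type u} [Field k]
    {A : Type v} [CommRing A] [Algebra k A] {P : PoissonStructure k A}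
    {n : ℕ} [IsDomain (⨂[k] _ : Fin n, A)]
    (f : Fin (n + 1) → A) (h0 : classicalDelta k f 0 ≠ 0)
    {H : Type w} [Ring H] [Algebra (PowerSeries k) H] (D : PreQuantization P H)
    (E : PreQuantization (P.tensorPower n) (⨂[PowerSeries k] _ : Fin n, H))
    (hE : ∀ a : Fin n → H,
      E.proj (PiTensorProduct.tprod _ a) = PiTensorProduct.tprod k fun i => D.proj (a i)) :
    Nonempty (FamilyQuantization (P.tensorPower n).fraction (classicalFamily k f)
      E.completeLocalization) := by
  let K := FractionRing (⨂[k] _ : Fin n, A)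
  let Q := E.completeLocalizationQuantization
  have hL := E.hbarComplete_completeLocalization
  choose F hF using fun j => D.proj_surjective (f j)
  let b : Fin n → Fin (n + 1) → E.completeLocalization := fun i j =>
    E.toCompleteLocalization (PiTensorProduct.tprod _ (Pi.mulSingle i (F j) : Fin n → H))
  have hb : ∀ i j, Q.proj (b i j) = algebraMap _ K (single k i (f j)) := by
    intro i j
    refine (E.completeProj_toCompleteLocalization _).trans ?_
    rw [hE, PoissonStructure.single, PiTensorProduct.singleAlgHom_apply]
    congr 2
    ext l
    by_cases hl : l = i
    · subst hl; simp [hF]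
    · simp [hl]
  have hcomm : ∀ i i', i ≠ i' → ∀ j l, Commute (b i j) (b i' l) := fun i i' hi j l =>
    (Commute.tprod (Pi.mulSingle_commute (f := fun _ : Fin n => H) hi (F j) (F l))).map
      E.toCompleteLocalization
  let M : Matrix (Fin n) (Fin n) E.completeLocalization := Matrix.of fun i j => b i j.succ
  have hdet : (M.map Q.proj).det = algebraMap _ K (classicalDelta k f 0) := by
    rw [classicalDelta, antisymTensor_eq_det, RingHom.map_det, ← det_transpose]
    congr 1
    ext i j
    exact hb j i.succ
  have hd0 : algebraMap _ K (classicalDelta k f 0) ≠ 0 :=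
    IsFractionRing.to_map_ne_zero_of_mem_nonZeroDivisors (mem_nonZeroDivisors_of_ne_zero h0)
  have hM : (M.map Q.proj).det ≠ 0 := by rw [hdet]; exact hd0
  obtain ⟨x, hx⟩ := Q.exists_mulVec_eq hL M hM fun i => -b i 0
  have hxc := Q.commute_of_mulVec_eq hL M hM _ x hx
    (fun i i' hi j l => hcomm i i' hi _ _) (fun i i' hi j => (hcomm i i' hi _ _).neg_right)
    (fun i i' hi => (hcomm i i' hi _ _).neg_left.neg_right)
  -- The reduction of `x` solves the same linear system as the signed classical family.
  have hproj : Q.proj ∘ x = fun i : Fin n => (-1) ^ ((i : ℕ) + 1) * classicalFamily k f i := by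
    apply mulVec_injective_of_isUnit ((isUnit_iff_isUnit_det _).mpr (Ne.isUnit hM))
    ext i
    rw [← RingHom.map_mulVec, hx, map_neg, hb, neg_eq_iff_add_eq_zero]
    have h := congrArg (algebraMap _ K) (sum_single_mul_classicalDelta (k := k) f i)
    rw [Fin.sum_univ_succ, map_add, map_sum, map_zero] at h
    have h' := congrArg (· / algebraMap _ K (classicalDelta k f 0)) h
    simp only [map_mul, map_pow, map_neg, map_one, Fin.val_zero, pow_zero, one_mul, zero_div,
      add_div, mul_div_cancel_right₀ _ hd0, Finset.sum_div, Fin.val_succ] at h'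
    refine Eq.trans ?_ h'
    change _ + ∑ j : Fin n, M.map Q.proj i j * ((-1) ^ ((j : ℕ) + 1) * classicalFamily k f j) = _
    refine congrArg₂ (· + ·) rfl (Finset.sum_congr rfl fun j _ => ?_)
    rw [map_apply, classicalFamily, mul_div_assoc]
    have e : Q.proj (M i j) = algebraMap _ K (single k i (f j.succ)) := hb i j.succ
    rw [e]
    ring
  refine ⟨{ Q with
    lift := fun i => (-1) ^ ((i : ℕ) + 1) * x i
    lift_commute := fun i j => ?_
    proj_lift := fun i => ?_ }⟩
  · have h1 : ∀ (m : ℕ) (y : E.completeLocalization), Commute ((-1) ^ m) y := fun m y =>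
      (Commute.neg_one_left y).pow_left m
    exact (h1 _ _).mul_left ((h1 _ _).symm.mul_right (hxc i j))
  · change Q.proj ((-1) ^ ((i : ℕ) + 1) * x i) = _
    have h := congrFun hproj i
    rw [Function.comp_apply] at h
    rw [map_mul, h, map_pow, map_neg, map_one, ← mul_assoc, ← mul_pow]
    simp

theorem mainTheorem5 {k : Type u} [Field k] (hk : (2 : k) ≠ 0)
    {A : Type v} [CommRing A] [Algebra k A] (P : PoissonStructure k A)
    (n : ℕ) [IsDomain (⨂[k] _ : Fin n, A)]
    (f : Fin (n + 1) → A) (hf : LinearIndependent k f)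
    (Ah : Type w) [Ring Ah] [Algebra (PowerSeries k) Ah] (Q : Quantization P Ah) :
    classicalDelta k f 0 ≠ 0 ∧
      ∃ (Kh : Type (max u v w)) (_ : Ring Kh) (_ : Algebra (PowerSeries k) Kh),
        Nonempty (FamilyQuantization (P.tensorPower n).fraction (classicalFamily k f) Kh) := by
  have h0 : classicalDelta k f 0 ≠ 0 :=
    antisymTensor_ne_zero (hf.comp _ Fin.succAbove_right_injective)
  obtain ⟨E, hE⟩ := Q.toPreQuantization.exists_tensorPower n
  exact ⟨h0, E.completeLocalization, inferInstance, inferInstance,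
    exists_familyQuantization f h0 _ E hE⟩
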